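/- **Theorem.** A *map* of metric spaces means a $1$-Lipschitz function, i.e. one with $d(f(x),f(x'))\le d(x,x')$. Two points $x,y$ of a metric space $X$ are *adjacent* if $x\ne y$ and there is no $p\in X\setminus\{x,y\}$ with $d(x,y)=d(x,p)+d(p,y)$; the *inner boundary* $\rho X$ is the set of points of $X$ that are adjacent to some point of $X$. A *closed Euclidean set* is a metric space $X$ isometric to a closed subset of $\mathbb{R}^N$ (Euclidean metric) for some $N\ge 0$; having identified $X$ with such a subset, its *core* is $\operatorname{core}(X)=X\cap\overline{\operatorname{conv}}(\rho X)$, where $\overline{\operatorname{conv}}$ is the closed convex hull in $\mathbb{R}^N$. For a metric space $X$, an integer $n\ge 0$ and a real $\ell\ge 0$, let $MC_{n,\ell}(X)$ be the free abelian group on the tuples $(x_0,\dots,x_n)\in X^{n+1}$ with $x_{i-1}\ne x_i$ for $1\le i\le n$ and length $\sum_{i=1}^n d(x_{i-1},x_i)=\ell$. The boundary map $\partial:MC_{n,\ell}(X)\to MC_{n-1,\ell}(X)$ ($n\ge1$) is $\sum_{i=0}^n(-1)^i\partial^i$, where $\partial^i$ deletes the entry $x_i$ if the resulting tuple still has length $\ell$,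 and is $0$ otherwise. The *magnitude homology* $MH_{n,\ell}(X)$ is the $n$th homology of $MC_{*,\ell}(X)$, and $MH_n(X)=\bigoplus_{\ell\ge0}MH_{n,\ell}(X)$ as a graded group. A map $f:X\to Y$ induces $f_*:MH_{n}(X)\to MH_{n}(Y)$ through the chain map sending $(x_0,\dots,x_n)$ of length $\ell$ to $(f(x_0),\dots,f(x_n))$ if the latter is a generator of $MC_{n,\ell}(Y)$, and to $0$ otherwise. Let $X$ and $Y$ be nonempty closed Euclidean sets, each identified with a closed subset of a Euclidean space (of possibly different dimensions). The following are equivalent: 1. $X$ and $Y$ are magnitude homology equivalent, that is, there exist maps $f:X\to Y$ and $g:Y\to X$ such that $f_*:MH_n(X)\to MH_n(Y)$ and $g_*:MH_n(Y)\to MH_n(X)$ are mutually inverse for all $n\ge1$; 2. there exist maps $f:X\to Y$ and $g:Y\to X$ such that $f_*:MH_n(X)\to MH_n(Y)$ and $g_*:MH_n(Y)\to MH_n(X)$ are mutually inverse for some $n\ge1$; 3. there exist maps $f:X\to Y$ and $g:Y\to X$ that restrict to mutually inverse isometries between $\rho X$ and $\rho Y$; 4. there exist maps $f:X\to Y$ and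 $g:Y\to X$ that restrict to mutually inverse isometries between $\operatorname{core}(X)$ and $\operatorname{core}(Y)$; 5. $\operatorname{core}(X)$ and $\operatorname{core}(Y)$ are isometric (there is a distance-preserving bijection between them). -/

import Mathlib

open scoped NNReal

/-! ### Betweenness, adjacency, inner boundary and core -/

/-- `y` is strictly between `x` and `z` in a metric space. -/
def StrictlyBetween {X : Type*} [MetricSpace X] (x y z : X) : Prop :=
  dist x z = dist x y + dist y z ∧ x ≠ y ∧ y ≠ z

/-- Two points are adjacent if they are distinct and no point is strictly between them. -/
def AdjacentPoints {X : Type*} [MetricSpace X] (x y : X) : Prop :=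
  x ≠ y ∧ ∀ p : X, ¬ StrictlyBetween x p y

/-- The inner boundary of a metric space: the points that are adjacent to some point. -/
def innerBoundary (X : Type*) [MetricSpace X] : Set X :=
  {x | ∃ y : X, AdjacentPoints x y}

/-- The core of `X`, where `X` is regarded as a subset of `ℝ^N` through `i`: the points of `X` in
the closed convex hull (taken in `ℝ^N`) of the inner boundary. For a subset `X` of `ℝ^N` itself,
`i` is the inclusion. -/
def core {X : Type*} [MetricSpace X] {N : ℕ} (i : X → EuclideanSpace ℝ (Fin N)) : Set X :=
  {x | i x ∈ closedConvexHull ℝ (i '' innerBoundary X)}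

/-- The functions `f` and `g` restrict to mutually inverse isometries between `A` and `B`. -/
structure RestrictToInverseIsometries {X Y : Type*} [MetricSpace X] [MetricSpace Y]
    (f : X → Y) (g : Y → X) (A : Set X) (B : Set Y) : Prop where
  mapsTo : Set.MapsTo f A B
  mapsTo_inv : Set.MapsTo g B A
  left_inv : ∀ x ∈ A, g (f x) = x
  right_inv : ∀ y ∈ B, f (g y) = y
  dist_eq : ∀ x ∈ A, ∀ x' ∈ A, dist (f x) (f x') = dist x x'
  dist_inv_eq : ∀ y ∈ B, ∀ y' ∈ B, dist (g y) (g y') = dist y y'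

/-! ### The magnitude chain complex -/

namespace MagnitudeHomology

section Chains

variable {X : Type*} [MetricSpace X]

/-- The length of a tuple `(x₀, …, xₙ)`. -/
noncomputable def length {n : ℕ} (x : Fin (n + 1) → X) : ℝ :=
  ∑ i : Fin n, dist (x i.castSucc) (x i.succ)

/-- `(x₀, …, xₙ)` is a proper chain of length `ℓ`. -/
def IsProperChain {n : ℕ} (ℓ : ℝ≥0) (x : Fin (n + 1) → X) : Prop :=
  (∀ i : Fin n, x i.castSucc ≠ x i.succ) ∧ length x = ℓ

variable (X) in
/-- The set of proper chains of degree `n` and length `ℓ`. -/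
abbrev ProperChain (n : ℕ) (ℓ : ℝ≥0) : Type _ :=
  {x : Fin (n + 1) → X // IsProperChain ℓ x}

variable (X) in
/-- The magnitude chains of degree `n` and length `ℓ`: the free abelian group on the proper
chains. -/
abbrev Chain (n : ℕ) (ℓ : ℝ≥0) : Type _ :=
  ProperChain X n ℓ →₀ ℤ

open Classical in
/-- The chain given by a tuple: the generator if the tuple is a proper chain of length `ℓ`, and `0`
otherwise. -/
noncomputable def gen {n : ℕ} (ℓ : ℝ≥0) (x : Fin (n + 1) → X) : Chain X n ℓ :=
  if h : IsProperChain ℓ x then Finsupp.single ⟨x, h⟩ 1 else 0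

variable (X) in
/-- The boundary map `∂ₙ₊₁` from degree `n + 1` to degree `n`, the alternating sum over `i` of the
maps that delete the `i`th entry if this preserves the length, and give `0` otherwise. (Deleting
an entry of a proper chain without changing its length gives a proper chain, see
`properChain_removeNth`.) -/
noncomputable def boundary (n : ℕ) (ℓ : ℝ≥0) : Chain X (n + 1) ℓ →ₗ[ℤ] Chain X n ℓ :=
  Finsupp.linearCombination ℤ fun x : ProperChain X (n + 1) ℓ =>
    ∑ i : Fin (n + 2), (-1 : ℤ) ^ (i : ℕ) • gen ℓ (i.removeNth x.1)

variable (X) in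
/-- The group of `n`-cycles of length `ℓ`; every `0`-chain is a cycle. -/
noncomputable def cycles : (n : ℕ) → (ℓ : ℝ≥0) → Submodule ℤ (Chain X n ℓ)
  | 0, _ => ⊤
  | n + 1, ℓ => LinearMap.ker (boundary X n ℓ)

variable (X) in
/-- The group of `n`-boundaries of length `ℓ`. -/
noncomputable def boundaries (n : ℕ) (ℓ : ℝ≥0) : Submodule ℤ (Chain X n ℓ) :=
  LinearMap.range (boundary X n ℓ)

variable (X) in
/-- The magnitude homology group `MH_{n,ℓ}(X)`: cycles modulo boundaries. (All boundaries are
cycles, see `boundaries_le_cycles`.) -/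
abbrev Homology (n : ℕ) (ℓ : ℝ≥0) : Type _ :=
  cycles X n ℓ ⧸ (boundaries X n ℓ).submoduleOf (cycles X n ℓ)

theorem length_succ {n : ℕ} (x : Fin (n + 2) → X) :
    length x = dist (x 0) (x 1) + length (Fin.tail x) := by
  simp only [length, Fin.tail, Fin.sum_univ_succ (n := n)]
  rfl

theorem tail_removeNth_succ {X : Type*} {n : ℕ} (x : Fin (n + 3) → X) (k : Fin (n + 2)) :
    Fin.tail (k.succ.removeNth x) = k.removeNth (Fin.tail x) := by
  funext j
  simp [Fin.tail, Fin.removeNth]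

theorem length_removeNth_le {n : ℕ} (x : Fin (n + 2) → X) (i : Fin (n + 2)) :
    length (i.removeNth x) ≤ length x := by
  induction n with
  | zero => simp [length]
  | succ n ih =>
    have key := length_succ x
    have hx0 := dist_nonneg (x := x 0) (y := x 1)
    cases i using Fin.cases with
    | zero =>
      have : (0 : Fin (n + 3)).removeNth x = Fin.tail x := by
        funext j; simp [Fin.removeNth, Fin.tail]
      rw [this]
      linarith
    | succ k =>
      have e := length_succ (k.succ.removeNth x)
      rw [tail_removeNth_succ] at e
      cases k using Fin.cases with
      | zero =>
        have h0 : (0 : Fin (n + 2)).removeNth (Fin.tail x) = Fin.tail (Fin.tail x) := by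
          funext j; simp [Fin.removeNth, Fin.tail]
        have h1 : (Fin.succ 0).removeNth x 0 = x 0 := rfl
        have h2 : (Fin.succ 0).removeNth x 1 = x 2 := rfl
        have h3 := length_succ (Fin.tail x)
        have h4 : Fin.tail x 0 = x 1 := rfl
        have h5 : Fin.tail x 1 = x 2 := rfl
        have h6 := dist_triangle (x 0) (x 1) (x 2)
        rw [h0, h1, h2] at e
        rw [h4, h5] at h3
        linarith
      | succ k =>
        have h1 : (k.succ.succ).removeNth x 0 = x 0 := rfl
        have h2 : (k.succ.succ).removeNth x 1 = x 1 := rfl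
        have h3 := ih (Fin.tail x) k.succ
        rw [h1, h2] at e
        linarith

theorem proper_removeNth {n : ℕ} (x : Fin (n + 2) → X) (i : Fin (n + 2))
    (hx : ∀ j : Fin (n + 1), x j.castSucc ≠ x j.succ)
    (h : length (i.removeNth x) = length x) (j : Fin n) :
    i.removeNth x j.castSucc ≠ i.removeNth x j.succ := by
  induction n with
  | zero => exact j.elim0
  | succ n ih =>
    have key := length_succ x
    have hx0 : 0 < dist (x 0) (x 1) := dist_pos.2 (hx 0)
    have hx1 : ∀ j : Fin (n + 1), Fin.tail x j.castSucc ≠ Fin.tail x j.succ := fun j => hx j.succ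
    cases i using Fin.cases with
    | zero =>
      have : (0 : Fin (n + 3)).removeNth x = Fin.tail x := by
        funext j; simp [Fin.removeNth, Fin.tail]
      rw [this] at h
      linarith
    | succ k =>
      have e := length_succ (k.succ.removeNth x)
      rw [tail_removeNth_succ] at e
      cases k using Fin.cases with
      | zero =>
        have h0 : (0 : Fin (n + 2)).removeNth (Fin.tail x) = Fin.tail (Fin.tail x) := by
          funext j; simp [Fin.removeNth, Fin.tail]
        have h1 : (Fin.succ 0).removeNth x 0 = x 0 := rfl
        have h2 : (Fin.succ 0).removeNth x 1 = x 2 := rfl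
        have h3 := length_succ (Fin.tail x)
        have h4 : Fin.tail x 0 = x 1 := rfl
        have h5 : Fin.tail x 1 = x 2 := rfl
        have h6 : 0 < dist (x 1) (x 2) := dist_pos.2 (hx 1)
        rw [h0, h1, h2] at e
        rw [h4, h5] at h3
        cases j using Fin.cases with
        | zero =>
          have h7 : 0 < dist (x 0) (x 2) := by linarith
          exact dist_pos.1 h7
        | succ j => exact hx j.succ.succ
      | succ k =>
        have h1 : (k.succ.succ).removeNth x 0 = x 0 := rfl
        have h2 : (k.succ.succ).removeNth x 1 = x 1 := rfl
        rw [h1, h2] at e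
        cases j using Fin.cases with
        | zero => exact hx 0
        | succ j =>
          have h3 := ih (Fin.tail x) k.succ hx1 (by linarith) j
          rw [← tail_removeNth_succ] at h3
          exact h3

/-- Deleting an entry of a proper chain without changing its length gives a proper chain. -/
theorem properChain_removeNth {n : ℕ} {ℓ : ℝ≥0} (x : ProperChain X (n + 1) ℓ) (i : Fin (n + 2)) :
    IsProperChain ℓ (i.removeNth x.1) ↔ length (i.removeNth x.1) = ℓ := by
  refine ⟨fun h => h.2, fun h => ⟨proper_removeNth x.1 i x.2.1 (h.trans x.2.2.symm), h⟩⟩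

theorem boundary_gen_removeNth {n : ℕ} {ℓ : ℝ≥0} (x : ProperChain X (n + 2) ℓ)
    (i : Fin (n + 3)) :
    boundary X n ℓ (gen ℓ (i.removeNth x.1)) =
      ∑ j : Fin (n + 2), (-1 : ℤ) ^ (j : ℕ) • gen ℓ (j.removeNth (i.removeNth x.1)) := by
  by_cases h : IsProperChain ℓ (i.removeNth x.1)
  · simp [gen, h, boundary]
  · have h0 : gen ℓ (i.removeNth x.1) = 0 := by simp [gen, h]
    rw [h0, map_zero]
    symm
    refine Finset.sum_eq_zero fun j _ => ?_
    have : ¬ IsProperChain ℓ (j.removeNth (i.removeNth x.1)) := by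
      intro hj
      apply h
      rw [properChain_removeNth]
      apply le_antisymm
      · exact (length_removeNth_le _ _).trans x.2.2.le
      · exact hj.2.symm.le.trans (length_removeNth_le _ _)
    simp [gen, this]

theorem boundary_boundary (n : ℕ) (ℓ : ℝ≥0) :
    boundary X n ℓ ∘ₗ boundary X (n + 1) ℓ = 0 := by
  refine Finsupp.lhom_ext' fun x => LinearMap.ext_ring ?_
  have h1 : boundary X (n + 1) ℓ (Finsupp.single x 1) =
      ∑ i : Fin (n + 3), (-1 : ℤ) ^ (i : ℕ) • gen ℓ (i.removeNth x.1) := by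
    simp [boundary]
  simp only [LinearMap.comp_apply, Finsupp.lsingle_apply, LinearMap.zero_apply, h1, map_sum,
    map_smul, boundary_gen_removeNth, Finset.smul_sum, smul_smul]
  rw [← Finset.sum_product']
  refine Finset.sum_involution
    (fun (p : Fin (n + 3) × Fin (n + 2)) _ => (p.1.succAbove p.2, p.2.predAbove p.1)) ?_ ?_ ?_ ?_
  · rintro ⟨i, j⟩ -
    simp only
    rw [← Fin.removeNth_removeNth_eq_swap, ← add_smul, ← pow_add, ← pow_add,
      Fin.neg_one_pow_succAbove_add_predAbove]
    simp
  · rintro ⟨i, j⟩ - - h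
    exact Fin.succAbove_ne i j (congrArg Prod.fst h)
  · simp
  · rintro ⟨i, j⟩ -
    simp [Fin.succAbove_succAbove_predAbove, Fin.predAbove_predAbove_succAbove]

theorem boundaries_le_cycles (n : ℕ) (ℓ : ℝ≥0) : boundaries X n ℓ ≤ cycles X n ℓ := by
  cases n with
  | zero => exact le_top
  | succ n =>
    rintro _ ⟨c, rfl⟩
    exact LinearMap.congr_fun (boundary_boundary n ℓ) c

end Chains

/-! ### Induced maps -/

section Maps

variable {X Y : Type*} [MetricSpace X] [MetricSpace Y]

/-- The map of chains induced by `f`: it sends `(x₀, …, xₙ)` to `(f x₀, …, f xₙ)` if the latter is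
a proper chain of length `ℓ`, and to `0` otherwise. -/
noncomputable def chainMap (f : X → Y) (n : ℕ) (ℓ : ℝ≥0) : Chain X n ℓ →ₗ[ℤ] Chain Y n ℓ :=
  Finsupp.linearCombination ℤ fun x : ProperChain X n ℓ => gen ℓ (f ∘ x.1)

theorem length_comp_le {f : X → Y} (hf : LipschitzWith 1 f) {n : ℕ} (x : Fin (n + 1) → X) :
    length (f ∘ x) ≤ length x :=
  Finset.sum_le_sum fun i _ => by simpa using hf.dist_le_mul (x i.castSucc) (x i.succ)

theorem proper_of_comp {f : X → Y} (hf : LipschitzWith 1 f) {n : ℕ} (x : Fin (n + 1) → X)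
    (hx : ∀ j : Fin n, x j.castSucc ≠ x j.succ) (h : length (f ∘ x) = length x) (j : Fin n) :
    (f ∘ x) j.castSucc ≠ (f ∘ x) j.succ := by
  have hle : ∀ i ∈ Finset.univ, dist ((f ∘ x) (Fin.castSucc i)) ((f ∘ x) i.succ) ≤
      dist (x (Fin.castSucc i)) (x i.succ) :=
    fun i _ => by simpa using hf.dist_le_mul (x i.castSucc) (x i.succ)
  have := (Finset.sum_eq_sum_iff_of_le hle).1 h j (Finset.mem_univ _)
  rw [← dist_pos, this, dist_pos]
  exact hx j

theorem boundary_comp_chainMap {f : X → Y} (hf : LipschitzWith 1 f) (n : ℕ) (ℓ : ℝ≥0) :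
    boundary Y n ℓ ∘ₗ chainMap f (n + 1) ℓ = chainMap f n ℓ ∘ₗ boundary X n ℓ := by
  refine Finsupp.lhom_ext' fun x => LinearMap.ext_ring ?_
  have hR : chainMap f n ℓ (boundary X n ℓ (Finsupp.single x 1)) =
      ∑ i : Fin (n + 2), (-1 : ℤ) ^ (i : ℕ) • gen ℓ (i.removeNth (f ∘ x.1)) := by
    simp only [boundary, Finsupp.linearCombination_single, one_smul, map_sum, map_smul]
    refine Finset.sum_congr rfl fun i _ => ?_
    congr 1
    by_cases h : IsProperChain ℓ (i.removeNth x.1)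
    · simp only [gen, h, dif_pos, chainMap, Finsupp.linearCombination_single, one_smul]
      rfl
    · have h' : ¬ IsProperChain ℓ (i.removeNth (f ∘ x.1)) := by
        intro h'
        apply h
        rw [properChain_removeNth]
        refine le_antisymm ((length_removeNth_le _ _).trans x.2.2.le) ?_
        exact h'.2.symm.le.trans (length_comp_le hf (i.removeNth x.1))
      simp [gen, h, h']
  have hL : boundary Y n ℓ (chainMap f (n + 1) ℓ (Finsupp.single x 1)) =
      ∑ i : Fin (n + 2), (-1 : ℤ) ^ (i : ℕ) • gen ℓ (i.removeNth (f ∘ x.1)) := by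
    by_cases h : IsProperChain ℓ (f ∘ x.1)
    · simp [chainMap, gen, h, boundary]
    · have h0 : chainMap f (n + 1) ℓ (Finsupp.single x 1) = 0 := by simp [chainMap, gen, h]
      rw [h0, map_zero]
      symm
      refine Finset.sum_eq_zero fun i _ => ?_
      have : ¬ IsProperChain ℓ (i.removeNth (f ∘ x.1)) := by
        intro hi
        apply h
        have hl : length (f ∘ x.1) = ℓ :=
          le_antisymm ((length_comp_le hf _).trans x.2.2.le)
            (hi.2.symm.le.trans (length_removeNth_le _ _))
        exact ⟨proper_of_comp hf x.1 x.2.1 (hl.trans x.2.2.symm), hl⟩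
      simp [gen, this]
  simp only [LinearMap.comp_apply, Finsupp.lsingle_apply, hL, hR]

theorem chainMap_mem_cycles {f : X → Y} (hf : LipschitzWith 1 f) (n : ℕ) (ℓ : ℝ≥0) :
    ∀ c ∈ cycles X n ℓ, chainMap f n ℓ c ∈ cycles Y n ℓ := by
  cases n with
  | zero => exact fun _ _ => Submodule.mem_top
  | succ n =>
    intro c hc
    have h := LinearMap.congr_fun (boundary_comp_chainMap hf n ℓ) c
    have hc' : boundary X n ℓ c = 0 := hc
    simp only [LinearMap.comp_apply, hc', map_zero] at h
    exact h

theorem chainMap_mem_boundaries {f : X → Y} (hf : LipschitzWith 1 f) (n : ℕ) (ℓ : ℝ≥0) :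
    ∀ c ∈ boundaries X n ℓ, chainMap f n ℓ c ∈ boundaries Y n ℓ := by
  rintro _ ⟨c, rfl⟩
  exact ⟨chainMap f (n + 1) ℓ c, LinearMap.congr_fun (boundary_comp_chainMap hf n ℓ) c⟩

/-- The homomorphism `f_* : MH_{n,ℓ}(X) → MH_{n,ℓ}(Y)` induced by a `1`-Lipschitz map `f`. -/
noncomputable def map (f : X → Y) (hf : LipschitzWith 1 f) (n : ℕ) (ℓ : ℝ≥0) :
    Homology X n ℓ →ₗ[ℤ] Homology Y n ℓ :=
  Submodule.mapQ _ _ ((chainMap f n ℓ).restrict (chainMap_mem_cycles hf n ℓ))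
    fun c hc => chainMap_mem_boundaries hf n ℓ c hc

/-- The maps induced by `f` and `g` on the `n`th magnitude homology (in every length) are mutually
inverse. -/
def MutuallyInverse (f : X → Y) (g : Y → X) (hf : LipschitzWith 1 f) (hg : LipschitzWith 1 g)
    (n : ℕ) : Prop :=
  ∀ ℓ : ℝ≥0, map g hg n ℓ ∘ₗ map f hf n ℓ = LinearMap.id ∧
    map f hf n ℓ ∘ₗ map g hg n ℓ = LinearMap.id

end Maps

end MagnitudeHomology

/-- Magnitude homology equivalence: there are `1`-Lipschitz maps back and forth inducing mutually
inverse maps on magnitude homology in every positive degree. -/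
def MagnitudeHomologyEquivalent (X Y : Type*) [MetricSpace X] [MetricSpace Y] : Prop :=
  ∃ (f : X → Y) (g : Y → X) (hf : LipschitzWith 1 f) (hg : LipschitzWith 1 g),
    ∀ n : ℕ, 1 ≤ n → MagnitudeHomology.MutuallyInverse f g hf hg n

/-! ### Betweenness in aligned spaces -/

section Betweenness

variable {X : Type*} [MetricSpace X] {a b c d p q : X}

/-! The inner boundary `ρX` controls both the homology in positive degrees and, through its closed
convex hull, the core.

Homology. In a Euclidean set betweenness behaves as on a line. Take a cycle and the finite set `F`
of entries that occur in it. Read each tuple from the left up to the first obstruction: either a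
step between points not adjacent relative to `F`, into which the nearest intermediate point of `F`
can be inserted, or an entry strictly between its neighbours, which can be deleted. These moves are
mutually inverse and pair lower tuples with upper ones. Every other face of an upper tuple is again
upper, so modulo upper tuples the boundary sends each upper tuple to plus or minus its partner.
Hence the cycle is homologous to a combination of unpaired, critical tuples
(`exists_critical_of_cycle`). A critical tuple either has all entries in `ρX` or bounds a tuple with
one more point (`mem_boundaries_or_of_critical`). So a 1-Lipschitz self-map fixing `ρX` acts as the
identity on homology in positive degrees. Conversely, for adjacent `x`, `y` the tuple `(x, y, x, …)`
is a cycle that occurs in no boundary, so if `g ∘ f` acts as the identity in one positive degree, it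
fixes `x` and `y` (`fixed_of_adjacentPoints`).

Geometry. Let `C` be the closed convex hull of `ρX`. A gap of `X` in a segment between two of its
points is bounded by adjacent points, hence lies in `C`. It follows that segments from `X` to `C`
stay in `X ∪ C`, so the nearest point of `C` to a point of `X` lies in `X`: when `ρX` is nonempty,
`X` retracts onto its core by a 1-Lipschitz map (`exists_retraction`). Such retractions extend
isometries of cores to 1-Lipschitz maps. A 1-Lipschitz self-map fixing `ρX` also fixes the core, by
a half-space argument (`mem_closedConvexHull_of_dist_le`). -/

theorem StrictlyBetween.symm (h : StrictlyBetween a b c) : StrictlyBetween c b a := by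
  refine ⟨?_, h.2.2.symm, h.2.1.symm⟩
  rw [dist_comm c a, dist_comm c b, dist_comm b a, h.1, add_comm]

theorem StrictlyBetween.ne (h : StrictlyBetween a b c) : a ≠ c := by
  have h1 := dist_pos.2 h.2.1
  have h2 := dist_pos.2 h.2.2
  rw [← dist_pos, h.1]
  positivity

theorem StrictlyBetween.trans_middle (h₁ : StrictlyBetween a b d) (h₂ : StrictlyBetween b c d) :
    StrictlyBetween a b c := by
  refine ⟨le_antisymm (dist_triangle _ _ _) ?_, h₁.2.1, h₂.2.1⟩
  have := dist_triangle a c d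
  linarith [h₁.1, h₂.1]

theorem StrictlyBetween.trans_right (h₁ : StrictlyBetween a b d) (h₂ : StrictlyBetween b c d) :
    StrictlyBetween a c d := by
  have h := h₁.trans_middle h₂
  exact ⟨by linarith [h₁.1, h₂.1, h.1], h.ne, h₂.2.2⟩

theorem StrictlyBetween.trans_left (h₁ : StrictlyBetween a c d) (h₂ : StrictlyBetween a b c) :
    StrictlyBetween a b d :=
  (h₁.symm.trans_right h₂.symm).symm

theorem AdjacentPoints.symm (h : AdjacentPoints a b) : AdjacentPoints b a :=
  ⟨h.1.symm, fun p hp => h.2 p hp.symm⟩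

variable (X) in
/-- A metric space is aligned if betweenness in it behaves as on a line. -/
structure IsAligned : Prop where
  expand : ∀ {a b c d : X}, StrictlyBetween a b c → StrictlyBetween b c d → StrictlyBetween a b d
  total : ∀ {a b p q : X}, StrictlyBetween a p b → StrictlyBetween a q b → p ≠ q →
    StrictlyBetween a p q ∨ StrictlyBetween a q p

theorem IsAligned.expand_right (hX : IsAligned X) (h₁ : StrictlyBetween a b c)
    (h₂ : StrictlyBetween b c d) : StrictlyBetween a c d :=
  (hX.expand h₂.symm h₁.symm).symm

theorem Isometry.strictlyBetween_iff {Y : Type*} [MetricSpace Y] {i : X → Y} (hi : Isometry i) :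
    StrictlyBetween (i a) (i b) (i c) ↔ StrictlyBetween a b c := by
  simp [StrictlyBetween, hi.dist_eq, hi.injective.eq_iff]

/-- Strict convexity is what turns equality in the triangle inequality into lying on the segment. -/
theorem strictlyBetween_iff_sbtw {E : Type*} [NormedAddCommGroup E] [NormedSpace ℝ E]
    [StrictConvexSpace ℝ E] {a b c : E} : StrictlyBetween a b c ↔ Sbtw ℝ a b c := by
  rw [StrictlyBetween, Sbtw, ← dist_add_dist_eq_iff, eq_comm, ne_comm]

theorem isAligned_of_isometry {E : Type*} [NormedAddCommGroup E] [NormedSpace ℝ E]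
    [StrictConvexSpace ℝ E] {i : X → E} (hi : Isometry i) : IsAligned X where
  expand {a b c d} h₁ h₂ := by
    rw [← hi.strictlyBetween_iff, strictlyBetween_iff_sbtw] at *
    exact h₁.trans_expand_left h₂
  total {a b p q} h₁ h₂ h := by
    have hne := hi.injective.ne h
    rw [← hi.strictlyBetween_iff, strictlyBetween_iff_sbtw] at h₁ h₂
    rw [← hi.strictlyBetween_iff, ← hi.strictlyBetween_iff, strictlyBetween_iff_sbtw,
      strictlyBetween_iff_sbtw]
    have h₃ : SameRay ℝ (i p -ᵥ i a) (i q -ᵥ i a) := by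
      refine h₁.wbtw.sameRay_vsub_left.trans h₂.wbtw.sameRay_vsub_left.symm fun h0 => ?_
      exact absurd (vsub_eq_zero_iff_eq.1 h0).symm h₁.left_ne_right
    rcases wbtw_total_of_sameRay_vsub_left h₃ with h | h
    · exact Or.inl ⟨h, h₁.ne_left, hne⟩
    · exact Or.inr ⟨h, h₂.ne_left, hne.symm⟩

/-- Adjacency relative to a set `F`: no point of `F` lies strictly between the two points. -/
def AdjacentIn (F : Set X) (a b : X) : Prop :=
  a ≠ b ∧ ∀ p ∈ F, ¬ StrictlyBetween a p b

/-- Of two distinct points between `a` and `b`, the one nearer to `a` spoils the adjacency of the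
other. This makes the pairing of tuples injective. -/
theorem AdjacentIn.eq_of_strictlyBetween (hX : IsAligned X) {F : Set X} (hp : p ∈ F) (hq : q ∈ F)
    (h₁ : StrictlyBetween a p b) (h₂ : StrictlyBetween a q b) (h₃ : AdjacentIn F a p)
    (h₄ : AdjacentIn F a q) : p = q := by
  by_contra h
  rcases hX.total h₁ h₂ h with h | h
  · exact h₄.2 p hp h
  · exact h₃.2 q hq h

/-- Choose the candidate nearest to `a`. Finiteness of `F` is essential: in an interval there is no
nearest point, which is why adjacency is taken relative to `F`. -/
theorem exists_adjacentIn_strictlyBetween {F : Set X} (hF : F.Finite) (hab : a ≠ b)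
    (h : ¬ AdjacentIn F a b) : ∃ p ∈ F, StrictlyBetween a p b ∧ AdjacentIn F a p := by
  have hne : {p ∈ F | StrictlyBetween a p b}.Nonempty := by
    simp only [AdjacentIn, not_and, not_forall, not_not] at h
    obtain ⟨p, hp, hpb⟩ := h hab
    exact ⟨p, hp, hpb⟩
  obtain ⟨p, ⟨hpF, hpb⟩, hmin⟩ :=
    Set.exists_min_image _ (fun p => dist a p) (hF.subset (Set.sep_subset _ _)) hne
  refine ⟨p, hpF, hpb, hpb.2.1, fun q hq hqp => ?_⟩
  have h1 := hmin q ⟨hq, hpb.trans_left hqp⟩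
  have h2 := dist_pos.2 hqp.2.2
  linarith [hqp.1]

end Betweenness

/-! ### Finite sequences and deletion of entries -/

section Sequences

variable {X : Type*}

/-- `(w 0, …, w n)` is obtained from `(z 0, …, z (n + 1))` by deleting the entry with index `r`. -/
def IsDeletion (r n : ℕ) (z w : ℕ → X) : Prop :=
  ∀ k ≤ n, w k = if k < r then z k else z (k + 1)

theorem IsDeletion.of_lt {r n k : ℕ} {z w : ℕ → X} (h : IsDeletion r n z w) (hr : r ≤ n + 1)
    (hk : k < r) : w k = z k := by
  rw [h k (by omega), if_pos hk]

theorem IsDeletion.of_ge {r n k : ℕ} {z w : ℕ → X} (h : IsDeletion r n z w) (hk : r ≤ k)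
    (hn : k ≤ n) : w k = z (k + 1) := by
  rw [h k hn, if_neg (by omega)]

variable [MetricSpace X]

/-- The entry with index `k + 1` of the sequence `z` is strictly between its neighbours. -/
def SmoothAt (z : ℕ → X) (k : ℕ) : Prop :=
  StrictlyBetween (z k) (z (k + 1)) (z (k + 2))

/-- The length of `(z 0, …, z n)`. -/
noncomputable def seqLength (n : ℕ) (z : ℕ → X) : ℝ :=
  ∑ k ∈ Finset.range n, dist (z k) (z (k + 1))

theorem seqLength_deletion_zero {n : ℕ} {z w : ℕ → X} (h : IsDeletion 0 n z w) :
    seqLength n w + dist (z 0) (z 1) = seqLength (n + 1) z := by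
  rw [seqLength, seqLength, Finset.sum_range_succ']
  congr 1
  refine Finset.sum_congr rfl fun k hk => ?_
  have := Finset.mem_range.1 hk
  rw [h.of_ge (Nat.zero_le k) (by omega), h.of_ge (Nat.zero_le _) (by omega)]

theorem seqLength_deletion_last {n : ℕ} {z w : ℕ → X} (h : IsDeletion (n + 1) n z w) :
    seqLength n w + dist (z n) (z (n + 1)) = seqLength (n + 1) z := by
  rw [seqLength, seqLength, Finset.sum_range_succ]
  congr 1
  refine Finset.sum_congr rfl fun k hk => ?_
  have := Finset.mem_range.1 hk
  rw [h.of_lt le_rfl (by omega), h.of_lt le_rfl (by omega)]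

/-- The length drops by the triangle defect at the deleted entry; the sum is arranged to avoid
subtraction. -/
theorem seqLength_deletion_succ {n k : ℕ} (hk : k + 1 ≤ n) {z w : ℕ → X}
    (h : IsDeletion (k + 1) n z w) :
    seqLength n w + (dist (z k) (z (k + 1)) + dist (z (k + 1)) (z (k + 2))) =
      seqLength (n + 1) z + dist (z k) (z (k + 2)) := by
  induction n, hk using Nat.le_induction with
  | base =>
    have h1 : seqLength k w = seqLength k z := by
      refine Finset.sum_congr rfl fun j hj => ?_
      have := Finset.mem_range.1 hj
      rw [h.of_lt (by omega) (by omega), h.of_lt (by omega) (by omega)]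
    have h2 : seqLength (k + 1) w = seqLength k w + dist (w k) (w (k + 1)) :=
      Finset.sum_range_succ _ _
    have h3 : seqLength (k + 1 + 1) z = seqLength k z + dist (z k) (z (k + 1)) +
        dist (z (k + 1)) (z (k + 2)) := by
      simp only [seqLength, Finset.sum_range_succ]
    rw [h2, h3, h1, h.of_lt (by omega) (by omega), h.of_ge le_rfl le_rfl]
    ring
  | succ n hn ih =>
    have h0 : IsDeletion (k + 1) n z w := fun j hj => h j (by omega)
    have h1 : seqLength (n + 1) w = seqLength n w + dist (w n) (w (n + 1)) :=
      Finset.sum_range_succ _ _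
    have h2 : seqLength (n + 1 + 1) z = seqLength (n + 1) z + dist (z (n + 1)) (z (n + 2)) :=
      Finset.sum_range_succ _ _
    rw [h1, h2, h.of_ge hn (by omega), h.of_ge (by omega) le_rfl]
    linarith [ih h0]

/-! ### Pairing of sequences by their first obstruction -/

variable (F : Set X) (n : ℕ) (z : ℕ → X)

/-- The first `i` steps of `z` are between points adjacent relative to `F`, and none of the entries
with indices `1, …, i` is strictly between its neighbours. -/
def RigidBefore (i : ℕ) : Prop :=
  ∀ k < i, AdjacentIn F (z k) (z (k + 1)) ∧ ¬ SmoothAt z k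

/-- The first `i` steps are rigid, the next one is between adjacent points and ends at a point which
is strictly between its neighbours. -/
def UpperAt (i : ℕ) : Prop :=
  i + 2 ≤ n ∧ RigidBefore F z i ∧ AdjacentIn F (z i) (z (i + 1)) ∧ SmoothAt z i

/-- The first `i` steps are rigid, and the next one is between points which are not adjacent. -/
def LowerAt (i : ℕ) : Prop :=
  i + 1 ≤ n ∧ RigidBefore F z i ∧ ¬ AdjacentIn F (z i) (z (i + 1))

/-- All steps are between adjacent points, and no entry is strictly between its neighbours. -/
def Critical : Prop :=
  (∀ k < n, AdjacentIn F (z k) (z (k + 1))) ∧ ∀ k, k + 2 ≤ n → ¬ SmoothAt z k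

variable {F n z}

theorem critical_or_upperAt_or_lowerAt :
    Critical F n z ∨ (∃ i, UpperAt F n z i) ∨ ∃ i, LowerAt F n z i := by
  classical
  -- Stop at the least obstructed index; if both obstructions occur there, the nonadjacent step
  -- takes precedence.
  by_cases h : ∃ i, (i < n ∧ ¬ AdjacentIn F (z i) (z (i + 1))) ∨ (i + 2 ≤ n ∧ SmoothAt z i)
  · right
    have hspec := Nat.find_spec h
    have hmin : ∀ k < Nat.find h, _ := fun k hk => Nat.find_min h hk
    set i := Nat.find h
    have hi : i < n := by omega
    have hpre : RigidBefore F z i := fun k hk => by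
      have := hmin k hk
      push Not at this
      exact ⟨this.1 (by omega), this.2 (by omega)⟩
    by_cases hadj : AdjacentIn F (z i) (z (i + 1))
    · rcases hspec with h1 | h1
      · exact absurd hadj h1.2
      · exact Or.inl ⟨i, h1.1, hpre, hadj, h1.2⟩
    · exact Or.inr ⟨i, hi, hpre, hadj⟩
  · left
    push Not at h
    exact ⟨fun k hk => (h k).1 hk, fun k hk => (h k).2 hk⟩

theorem LowerAt.unique {i j : ℕ} (hi : LowerAt F n z i) (hj : LowerAt F n z j) : i = j := by
  rcases lt_trichotomy i j with h | h | h
  · exact absurd (hj.2.1 i h).1 hi.2.2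
  · exact h
  · exact absurd (hi.2.1 j h).1 hj.2.2

theorem UpperAt.not_lowerAt {i j : ℕ} (hi : UpperAt F n z i) : ¬ LowerAt F n z j := by
  intro hj
  rcases lt_trichotomy i j with h | rfl | h
  · exact (hj.2.1 i h).2 hi.2.2.2
  · exact hj.2.2 hi.2.2.1
  · exact hj.2.2 (hi.2.1 j h).1

theorem UpperAt.not_critical {i : ℕ} (hi : UpperAt F n z i) : ¬ Critical F n z :=
  fun h => h.2 i hi.1 hi.2.2.2

theorem LowerAt.not_critical {i : ℕ} (hi : LowerAt F n z i) : ¬ Critical F n z :=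
  fun h => hi.2.2 (h.1 i hi.1)

theorem UpperAt.le_of_smoothAt {i r : ℕ} (hi : UpperAt F n z i) (h : SmoothAt z r) : i ≤ r :=
  not_lt.1 fun hr => (hi.2.1 r hr).2 h

/-- Smooth entries occur only from position `i + 1` on, so the deletion happens to the right of it.
Only `r = i + 1` changes a neighbour of that entry, and `expand` keeps it smooth. -/
theorem UpperAt.deletion (hX : IsAligned X) {i r : ℕ} {w : ℕ → X} (hi : UpperAt F (n + 1) z i)
    (hr : SmoothAt z r) (hrn : r + 1 ≤ n) (hne : r ≠ i) (hw : IsDeletion (r + 1) n z w) :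
    UpperAt F n w i := by
  have hir := hi.le_of_smoothAt hr
  have hlt : ∀ k, k < r + 1 → w k = z k := fun k hk => hw.of_lt (by omega) hk
  refine ⟨by omega, fun k hk => ?_, ?_, ?_⟩
  · have := hi.2.1 k hk
    rw [SmoothAt, hlt k (by omega), hlt (k + 1) (by omega), hlt (k + 2) (by omega)]
    exact this
  · rw [hlt i (by omega), hlt (i + 1) (by omega)]
    exact hi.2.2.1
  · rw [SmoothAt, hlt i (by omega), hlt (i + 1) (by omega)]
    by_cases h : r = i + 1
    · subst h
      rw [hw.of_ge le_rfl hrn]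
      exact hX.expand hi.2.2.2 hr
    · rw [hlt (i + 2) (by omega)]
      exact hi.2.2.2

theorem UpperAt.lowerAt_deletion {i : ℕ} {w : ℕ → X} (hi : UpperAt F (n + 1) z i)
    (hF : z (i + 1) ∈ F) (hw : IsDeletion (i + 1) n z w) : LowerAt F n w i := by
  have hin : i + 1 ≤ n := by have := hi.1; omega
  have hlt : ∀ k, k < i + 1 → w k = z k := fun k hk => hw.of_lt (by omega) hk
  have hge : w (i + 1) = z (i + 2) := hw.of_ge le_rfl hin
  refine ⟨hin, fun k hk => ?_, ?_⟩
  · have := hi.2.1 k hk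
    rw [SmoothAt, hlt k (by omega), hlt (k + 1) (by omega)]
    refine ⟨this.1, fun h => this.2 ?_⟩
    -- Only the entry with index `i` gets a new right neighbour; if it were smooth now, it would
    -- already have been smooth in `z`.
    by_cases hki : k + 1 = i
    · subst hki
      rw [hge] at h
      exact h.trans_middle hi.2.2.2
    · rw [hlt (k + 2) (by omega)] at h
      exact h
  · rw [hlt i (by omega), hge]
    exact fun h => h.2 _ hF hi.2.2.2

theorem UpperAt.eq_of_deletion (hX : IsAligned X) {i : ℕ} {z' w : ℕ → X}
    (hi : UpperAt F (n + 1) z i) (hi' : UpperAt F (n + 1) z' i) (hF : z (i + 1) ∈ F)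
    (hF' : z' (i + 1) ∈ F) (hw : IsDeletion (i + 1) n z w) (hw' : IsDeletion (i + 1) n z' w)
    {k : ℕ} (hk : k ≤ n + 1) : z k = z' k := by
  have hin : i + 1 ≤ n := by have := hi.1; omega
  rcases lt_trichotomy k (i + 1) with h | rfl | h
  · rw [← hw.of_lt (by omega) h, hw'.of_lt (by omega) h]
  · have h1 := hi.2.2.2
    have h2 := hi'.2.2.2
    have h3 := hi.2.2.1
    have h4 := hi'.2.2.1
    rw [SmoothAt, ← hw'.of_lt (by omega) (Nat.lt_succ_self i), ← hw'.of_ge le_rfl hin] at h2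
    rw [SmoothAt, ← hw.of_lt (by omega) (Nat.lt_succ_self i), ← hw.of_ge le_rfl hin] at h1
    rw [← hw'.of_lt (by omega) (Nat.lt_succ_self i)] at h4
    rw [← hw.of_lt (by omega) (Nat.lt_succ_self i)] at h3
    exact AdjacentIn.eq_of_strictlyBetween hX hF hF' h1 h2 h3 h4
  · obtain ⟨m, rfl⟩ : ∃ m, k = m + 1 := ⟨k - 1, by omega⟩
    rw [← hw.of_ge (by omega) (by omega), hw'.of_ge (by omega) (by omega)]

/-- Insertion inverts the deletion of the pairing: by `expand`, the inserted point cannot make the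
entry before it smooth. -/
theorem LowerAt.upperAt_of_deletion (hX : IsAligned X) {i : ℕ} {w : ℕ → X} (hi : LowerAt F n w i)
    (hw : IsDeletion (i + 1) n z w) (hp : StrictlyBetween (w i) (z (i + 1)) (w (i + 1)))
    (hadj : AdjacentIn F (w i) (z (i + 1))) : UpperAt F (n + 1) z i := by
  have hin := hi.1
  have hlt : ∀ k, k < i + 1 → w k = z k := fun k hk => hw.of_lt (by omega) hk
  refine ⟨by omega, fun k hk => ?_, ?_, ?_⟩
  · have := hi.2.1 k hk
    rw [hlt k (by omega), hlt (k + 1) (by omega), SmoothAt, hlt k (by omega),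
      hlt (k + 1) (by omega)] at this
    refine ⟨this.1, fun h => this.2 ?_⟩
    rw [SmoothAt] at h
    by_cases hki : k + 1 = i
    · subst hki
      rw [hlt (k + 1) (by omega)] at hp
      exact hX.expand h hp
    · rw [hlt (k + 2) (by omega)]
      exact h
  · rwa [← hlt i (by omega)]
  · rwa [SmoothAt, ← hlt i (by omega), ← hw.of_ge le_rfl hin]

/-- A point inserted into a critical sequence is the only smooth entry: a neighbour smooth after
insertion would, by `expand` or `expand_right`, have been smooth before. Hence the enlarged tuple
has just one nonzero face. -/
theorem Critical.eq_of_smoothAt_of_deletion (hX : IsAligned X) {i k : ℕ} {w : ℕ → X}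
    (h : Critical F n w) (hin : i + 1 ≤ n)
    (hw : IsDeletion (i + 1) n z w) (hp : StrictlyBetween (w i) (z (i + 1)) (w (i + 1)))
    (hk : k + 1 ≤ n) (hs : SmoothAt z k) : k = i := by
  have hlt : ∀ k, k < i + 1 → w k = z k := fun k hk => hw.of_lt (by omega) hk
  rw [SmoothAt] at hs
  by_contra hki
  rcases lt_or_gt_of_ne hki with hki | hki
  · refine h.2 k (by omega) ?_
    rw [← hlt k (by omega), ← hlt (k + 1) (by omega)] at hs
    by_cases hk1 : k + 1 = i
    · subst hk1
      exact hX.expand hs hp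
    · rw [← hlt (k + 2) (by omega)] at hs
      exact hs
  · obtain ⟨m, rfl⟩ : ∃ m, k = m + 1 := ⟨k - 1, by omega⟩
    refine h.2 m (by omega) ?_
    rw [← hw.of_ge (k := m + 2) (by omega) (by omega),
      ← hw.of_ge (k := m + 1) (by omega) (by omega)] at hs
    by_cases hm : m = i
    · subst hm
      exact hX.expand_right hp hs
    · rw [← hw.of_ge (k := m) (by omega) (by omega)] at hs
      exact hs

end Sequences

namespace MagnitudeHomology

/-! ### Chains as sequences -/

section Tuples

variable {X : Type*}

/-- A tuple as a sequence, extended by its last entry. -/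
def seq {n : ℕ} (x : Fin (n + 1) → X) (k : ℕ) : X :=
  x ⟨min k n, by omega⟩

theorem seq_apply {n : ℕ} (x : Fin (n + 1) → X) {k : ℕ} (hk : k < n + 1) :
    seq x k = x ⟨k, hk⟩ := by
  have : min k n = k := by omega
  simp only [seq, this]

theorem seq_val {n : ℕ} (x : Fin (n + 1) → X) (k : Fin (n + 1)) : seq x k = x k :=
  seq_apply x k.2

theorem eq_of_seq_eq {n : ℕ} {x y : Fin (n + 1) → X} (h : ∀ k ≤ n, seq x k = seq y k) :
    x = y := by
  funext k
  rw [← seq_val x, ← seq_val y, h k (by omega)]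

theorem isDeletion_removeNth {n : ℕ} (x : Fin (n + 2) → X) (r : Fin (n + 2)) :
    IsDeletion r n (seq x) (seq (r.removeNth x)) := by
  intro k hk
  rw [seq_apply _ (by omega : k < n + 1), seq_apply _ (by omega : k < n + 2),
    seq_apply _ (by omega : k + 1 < n + 2), Fin.removeNth]
  split_ifs with h
  · rw [Fin.succAbove_of_castSucc_lt _ _ (by simpa [Fin.lt_def] using h)]
    rfl
  · rw [Fin.succAbove_of_le_castSucc _ _ (by simpa [Fin.le_def] using h)]
    rfl

theorem isDeletion_insertNth {n i : ℕ} (x : Fin (n + 1) → X) (hi : i + 1 < n + 2) (p : X) :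
    IsDeletion (i + 1) n (seq (Fin.insertNth (α := fun _ => X) ⟨i + 1, hi⟩ p x)) (seq x) := by
  have := isDeletion_removeNth (Fin.insertNth (α := fun _ => X) ⟨i + 1, hi⟩ p x) ⟨i + 1, hi⟩
  rwa [Fin.removeNth_insertNth] at this

theorem seq_insertNth {n i : ℕ} (x : Fin (n + 1) → X) (hi : i + 1 < n + 2) (p : X) :
    seq (Fin.insertNth (α := fun _ => X) ⟨i + 1, hi⟩ p x) (i + 1) = p := by
  rw [seq_apply _ hi, Fin.insertNth_apply_same]

/-- The tuple `(x, y, x, y, …)`. -/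
def alternating (x y : X) (n : ℕ) (k : Fin (n + 1)) : X :=
  if Even (k : ℕ) then x else y

theorem seq_alternating {x y : X} {n k : ℕ} (hk : k ≤ n) :
    seq (alternating x y n) k = if Even k then x else y := by
  rw [seq_apply _ (by omega), alternating]

variable [MetricSpace X]

theorem seqLength_seq {n : ℕ} (x : Fin (n + 1) → X) : seqLength n (seq x) = length x := by
  rw [seqLength, length, Finset.sum_range]
  refine Finset.sum_congr rfl fun k _ => ?_
  rw [← seq_val x, ← seq_val x]
  rfl

theorem isProperChain_iff_seq {n : ℕ} {ℓ : ℝ≥0} {x : Fin (n + 1) → X} :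
    IsProperChain ℓ x ↔ (∀ k < n, seq x k ≠ seq x (k + 1)) ∧ seqLength n (seq x) = ℓ := by
  rw [seqLength_seq, IsProperChain]
  refine and_congr_left fun _ => ⟨fun h k hk => ?_, fun h k => ?_⟩
  · rw [seq_apply x (by omega : k < n + 1), seq_apply x (by omega : k + 1 < n + 1)]
    exact h ⟨k, hk⟩
  · have := h k k.2
    rw [seq_apply x (by omega : (k : ℕ) < n + 1), seq_apply x (by omega : (k : ℕ) + 1 < n + 1)]
      at this
    exact this

theorem ProperChain.seq_ne {n : ℕ} {ℓ : ℝ≥0} (x : ProperChain X n ℓ) {k : ℕ} (hk : k < n) :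
    seq x.1 k ≠ seq x.1 (k + 1) :=
  (isProperChain_iff_seq.1 x.2).1 k hk

theorem ProperChain.seqLength_eq {n : ℕ} {ℓ : ℝ≥0} (x : ProperChain X n ℓ) :
    seqLength n (seq x.1) = ℓ :=
  (isProperChain_iff_seq.1 x.2).2

/-- An entry can be deleted from a proper chain if and only if it is strictly between its
neighbours. -/
theorem isProperChain_removeNth_iff {n : ℕ} {ℓ : ℝ≥0} (x : ProperChain X (n + 1) ℓ)
    (r : Fin (n + 2)) :
    IsProperChain ℓ (r.removeNth x.1) ↔
      ∃ k, (r : ℕ) = k + 1 ∧ k + 1 ≤ n ∧ SmoothAt (seq x.1) k := by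
  have hd := isDeletion_removeNth x.1 r
  rw [properChain_removeNth, ← seqLength_seq, ← x.seqLength_eq]
  -- Deleting either end entry loses the positive length of the end step, so only interior indices
  -- survive.
  rcases Nat.eq_zero_or_pos (r : ℕ) with h0 | h0
  · rw [h0] at hd
    have := seqLength_deletion_zero hd
    have h1 := dist_pos.2 (x.seq_ne (Nat.succ_pos n))
    refine iff_of_false (fun h => ?_) (by rintro ⟨k, hk, -⟩; omega)
    rw [h] at this
    simp only [zero_add] at h1
    linarith
  obtain ⟨k, hk⟩ : ∃ k, (r : ℕ) = k + 1 := ⟨r - 1, by omega⟩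
  rw [hk] at hd
  by_cases hkn : k + 1 ≤ n
  · have := seqLength_deletion_succ hkn hd
    constructor
    · intro h
      exact ⟨k, hk, hkn, by linarith, x.seq_ne (by omega), x.seq_ne (by omega)⟩
    · rintro ⟨k', hk', -, hs⟩
      obtain rfl : k = k' := by omega
      linarith [hs.1]
  · obtain rfl : k = n := by have := r.2; omega
    have := seqLength_deletion_last hd
    have h1 := dist_pos.2 (x.seq_ne (Nat.lt_succ_self k))
    refine iff_of_false (fun h => ?_) (by rintro ⟨j, hj, h2, -⟩; omega)
    rw [h] at this
    linarith

theorem isProperChain_insertNth {n i : ℕ} {ℓ : ℝ≥0} (x : ProperChain X n ℓ) (hi : i + 1 ≤ n) {p : X}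
    (hp : StrictlyBetween (seq x.1 i) p (seq x.1 (i + 1))) :
    IsProperChain ℓ (Fin.insertNth (α := fun _ => X) ⟨i + 1, by omega⟩ p x.1) := by
  have hd := isDeletion_insertNth x.1 (by omega : i + 1 < n + 2) p
  have hs := seq_insertNth x.1 (by omega : i + 1 < n + 2) p
  set z := seq (Fin.insertNth (α := fun _ => X) ⟨i + 1, by omega⟩ p x.1) with hz
  have hzi : z i = seq x.1 i := (hd.of_lt (by omega) (by omega)).symm
  have hzi2 : z (i + 2) = seq x.1 (i + 1) := (hd.of_ge le_rfl hi).symm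
  rw [isProperChain_iff_seq, ← hz]
  constructor
  · intro k hk
    rcases lt_trichotomy k i with h | rfl | h
    · rw [← hd.of_lt (by omega) (by omega : k < i + 1),
        ← hd.of_lt (by omega) (by omega : k + 1 < i + 1)]
      exact x.seq_ne (by omega)
    · rw [hzi, hs]
      exact hp.2.1
    · obtain ⟨m, rfl⟩ : ∃ m, k = m + 1 := ⟨k - 1, by omega⟩
      rcases eq_or_ne m i with rfl | hm
      · rw [hs, hzi2]
        exact hp.2.2
      · rw [← hd.of_ge (by omega) (by omega : m ≤ n),
          ← hd.of_ge (by omega) (by omega : m + 1 ≤ n)]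
        exact x.seq_ne (by omega)
  · have := seqLength_deletion_succ hi hd
    rw [x.seqLength_eq, hs, hzi, hzi2, hp.1] at this
    linarith

end Tuples

/-! ### The boundary of a generator -/

section Boundary

variable {X : Type*} [MetricSpace X] {n : ℕ} {ℓ : ℝ≥0}

theorem gen_of_isProperChain {x : Fin (n + 1) → X} (h : IsProperChain ℓ x) :
    gen ℓ x = Finsupp.single ⟨x, h⟩ 1 := by
  simp [gen, h]

theorem gen_of_not_isProperChain {x : Fin (n + 1) → X} (h : ¬ IsProperChain ℓ x) :
    gen ℓ x = 0 := by
  simp [gen, h]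

theorem boundary_single (x : ProperChain X (n + 1) ℓ) :
    boundary X n ℓ (Finsupp.single x 1) =
      ∑ i : Fin (n + 2), (-1 : ℤ) ^ (i : ℕ) • gen ℓ (i.removeNth x.1) := by
  simp [boundary]

theorem boundary_single_eq_zero (x : ProperChain X (n + 1) ℓ)
    (hx : ∀ k, k + 1 ≤ n → ¬ SmoothAt (seq x.1) k) : boundary X n ℓ (Finsupp.single x 1) = 0 := by
  rw [boundary_single]
  refine Finset.sum_eq_zero fun i _ => ?_
  rw [gen_of_not_isProperChain, smul_zero]
  rw [isProperChain_removeNth_iff]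
  rintro ⟨k, -, hk, hs⟩
  exact hx k hk hs

/-- If `y` arises from `x` by deleting the entry with index `i + 1` and all other deletions of `x`
lie in the submodule `S`, then the boundary of `x` is `± y` modulo `S`. -/
theorem boundary_single_sub_mem (x : ProperChain X (n + 1) ℓ) {i : ℕ} (hi : i + 1 < n + 2)
    (y : ProperChain X n ℓ) (hy : Fin.removeNth (α := fun _ => X) ⟨i + 1, hi⟩ x.1 = y.1)
    (S : Submodule ℤ (Chain X n ℓ))
    (h : ∀ k, k + 1 ≤ n → SmoothAt (seq x.1) k → k ≠ i → ∀ w : ProperChain X n ℓ,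
      IsDeletion (k + 1) n (seq x.1) (seq w.1) → Finsupp.single w 1 ∈ S) :
    boundary X n ℓ (Finsupp.single x 1) - (-1 : ℤ) ^ (i + 1) • Finsupp.single y 1 ∈ S := by
  have hy' : gen ℓ (Fin.removeNth (α := fun _ => X) ⟨i + 1, hi⟩ x.1) = Finsupp.single y 1 := by
    rw [gen_of_isProperChain (hy ▸ y.2)]
    congr 1
    exact Subtype.ext hy
  rw [boundary_single, ← Finset.add_sum_erase _ _ (Finset.mem_univ (⟨i + 1, hi⟩ : Fin (n + 2))), hy',
    add_sub_cancel_left]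
  refine S.sum_mem fun r hr => S.smul_mem _ ?_
  by_cases hp : IsProperChain ℓ (r.removeNth x.1)
  · obtain ⟨k, hk, hkn, hs⟩ := (isProperChain_removeNth_iff x r).1 hp
    rw [gen_of_isProperChain hp]
    refine h k hkn hs ?_ _ (hk ▸ isDeletion_removeNth x.1 r)
    rintro rfl
    exact (Finset.mem_erase.1 hr).1 (Fin.ext hk)
  · rw [gen_of_not_isProperChain hp]
    exact S.zero_mem

end Boundary

/-! ### Reduction of cycles to critical chains -/

section Reduction

variable {X : Type*} [MetricSpace X] (F : Set X) (n : ℕ) (ℓ : ℝ≥0)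

/-- The proper chains with entries in `F`. -/
def chainsIn : Set (ProperChain X n ℓ) := {x | ∀ k, x.1 k ∈ F}

/-- The proper chains in `F` whose first nonrigid entry is strictly between its neighbours. -/
def upperChains : Set (ProperChain X n ℓ) := {x | x ∈ chainsIn F n ℓ ∧ ∃ i, UpperAt F n (seq x.1) i}

/-- The proper chains in `F` whose first nonrigid step is between nonadjacent points. -/
def lowerChains : Set (ProperChain X n ℓ) := {x | x ∈ chainsIn F n ℓ ∧ ∃ i, LowerAt F n (seq x.1) i}

/-- The proper chains in `F` which are critical relative to `F`. -/
def criticalChains : Set (ProperChain X n ℓ) :=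
  {x | x ∈ chainsIn F n ℓ ∧ Critical F n (seq x.1)}

variable {F n ℓ}

theorem seq_mem {x : ProperChain X n ℓ} (hx : x ∈ chainsIn F n ℓ) (k : ℕ) : seq x.1 k ∈ F :=
  hx _

theorem mem_chainsIn_of_isDeletion {r : ℕ} {x : ProperChain X (n + 1) ℓ} {w : ProperChain X n ℓ}
    (hx : x ∈ chainsIn F (n + 1) ℓ) (hw : IsDeletion r n (seq x.1) (seq w.1)) :
    w ∈ chainsIn F n ℓ := by
  intro k
  rw [← seq_val w.1, hw k (by omega)]
  split_ifs
  · exact seq_mem hx _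
  · exact seq_mem hx _

/-- The deletion pairing an upper chain with a lower chain. -/
theorem exists_lower_of_upper (hX : IsAligned X) {x : ProperChain X (n + 1) ℓ}
    (hx : x ∈ upperChains F (n + 1) ℓ) :
    ∃ i, UpperAt F (n + 1) (seq x.1) i ∧ ∃ y ∈ lowerChains F n ℓ, LowerAt F n (seq y.1) i ∧
      IsDeletion (i + 1) n (seq x.1) (seq y.1) ∧
      boundary X n ℓ (Finsupp.single x 1) - (-1 : ℤ) ^ (i + 1) • Finsupp.single y 1 ∈
        Finsupp.supported ℤ ℤ (upperChains F n ℓ) := by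
  obtain ⟨hxF, i, hi⟩ := hx
  have hin := hi.1
  have hp : IsProperChain ℓ (Fin.removeNth (α := fun _ => X) ⟨i + 1, by omega⟩ x.1) :=
    (isProperChain_removeNth_iff x _).2 ⟨i, rfl, by omega, hi.2.2.2⟩
  have hd := isDeletion_removeNth x.1 ⟨i + 1, by omega⟩
  have hl := hi.lowerAt_deletion (seq_mem hxF _) hd
  refine ⟨i, hi, ⟨_, hp⟩, ⟨mem_chainsIn_of_isDeletion hxF hd, i, hl⟩, hl, hd, ?_⟩
  refine boundary_single_sub_mem x (by omega) _ rfl _ fun k hk hs hne w hw => ?_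
  exact Finsupp.single_mem_supported ℤ _
    ⟨mem_chainsIn_of_isDeletion hxF hw, i, hi.deletion hX hs hk hne hw⟩

/-- Inserting the nearest point of `F` gives an upper tuple whose boundary is plus or minus the
given lower tuple, up to upper tuples. -/
theorem supported_lower_le (hX : IsAligned X) (hF : F.Finite) :
    Finsupp.supported ℤ ℤ (lowerChains F n ℓ) ≤
      boundaries X n ℓ ⊔ Finsupp.supported ℤ ℤ (upperChains F n ℓ) := by
  rw [Finsupp.supported_eq_span_single, Submodule.span_le]
  rintro _ ⟨y, ⟨hyF, i, hi⟩, rfl⟩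
  have hin := hi.1
  obtain ⟨p, hpF, hp, hadj⟩ :=
    exists_adjacentIn_strictlyBetween hF (y.seq_ne hin) hi.2.2
  have hd := isDeletion_insertNth y.1 (by omega : i + 1 < n + 2) p
  have hs := seq_insertNth y.1 (by omega : i + 1 < n + 2) p
  have hup := hi.upperAt_of_deletion hX hd (by rwa [hs]) (by rwa [hs])
  let x : ProperChain X (n + 1) ℓ := ⟨_, isProperChain_insertNth y hin hp⟩
  have hxF : x ∈ chainsIn F (n + 1) ℓ := by
    intro k
    induction k using Fin.succAboveCases (⟨i + 1, by omega⟩ : Fin (n + 2)) with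
    | x => simpa [x] using hpF
    | p k => simpa [x] using hyF k
  have hmem := boundary_single_sub_mem x (by omega : i + 1 < n + 2) y (by simp [x])
    (Finsupp.supported ℤ ℤ (upperChains F n ℓ)) fun k hk hs hne w hw =>
      Finsupp.single_mem_supported ℤ _
        ⟨mem_chainsIn_of_isDeletion hxF hw, i, hup.deletion hX hs hk hne hw⟩
  have hb : boundary X n ℓ (Finsupp.single x 1) ∈ boundaries X n ℓ := ⟨_, rfl⟩
  have h1 := Submodule.sub_mem _ (Submodule.mem_sup_left hb)
    (Submodule.mem_sup_right (S := boundaries X n ℓ) hmem)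
  rw [sub_sub_cancel] at h1
  have h2 := Submodule.smul_mem _ ((-1 : ℤ) ^ (i + 1)) h1
  rw [smul_smul, ← mul_pow] at h2
  simpa using h2

theorem boundary_eq_zero_of_critical {c : Chain X (n + 1) ℓ}
    (hc : c ∈ Finsupp.supported ℤ ℤ (criticalChains F (n + 1) ℓ)) : boundary X n ℓ c = 0 := by
  suffices h : Finsupp.supported ℤ ℤ (criticalChains F (n + 1) ℓ) ≤ LinearMap.ker (boundary X n ℓ) by
    exact h hc
  rw [Finsupp.supported_eq_span_single, Submodule.span_le]
  rintro _ ⟨y, hy, rfl⟩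
  exact boundary_single_eq_zero y fun k hk => hy.2.2 k (by omega)

/-- The boundary map is injective on combinations of upper chains. -/
theorem eq_zero_of_upper (hX : IsAligned X) {c : Chain X (n + 1) ℓ}
    (hc : c ∈ Finsupp.supported ℤ ℤ (upperChains F (n + 1) ℓ)) (h : boundary X n ℓ c = 0) :
    c = 0 := by
  classical
  have hc' : ∀ x ∈ c.support, x ∈ upperChains F (n + 1) ℓ :=
    fun x hx => (Finsupp.mem_supported ℤ c).1 hc hx
  by_contra hne
  obtain ⟨x, hx⟩ := Finsupp.support_nonempty_iff.2 hne
  obtain ⟨i, hi, y, hy, hyi, hd, hS⟩ := exists_lower_of_upper hX (hc' x hx)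
  -- `y` is lower, and no tuple is both upper and lower.
  have hvan : ∀ d ∈ Finsupp.supported ℤ ℤ (upperChains F n ℓ), d y = 0 := by
    intro d hd
    by_contra hdy
    obtain ⟨-, j, hj⟩ := (Finsupp.mem_supported ℤ d).1 hd (Finsupp.mem_support_iff.2 hdy)
    exact hj.not_lowerAt hyi
  have hxy : boundary X n ℓ (Finsupp.single x 1) y = (-1) ^ (i + 1) := by
    have := hvan _ hS
    simpa [sub_eq_zero] using this
  -- Another upper tuple reaches a lower tuple only through its own partner, and partners of
  -- distinct tuples differ.
  have hother : ∀ x' ∈ c.support, x' ≠ x → boundary X n ℓ (Finsupp.single x' 1) y = 0 := by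
    intro x' hx' hxx
    obtain ⟨i', hi', y', hy', hyi', hd', hS'⟩ := exists_lower_of_upper hX (hc' x' hx')
    have h1 := hvan _ hS'
    have hyy : y' ≠ y := by
      rintro rfl
      obtain rfl := hyi.unique hyi'
      refine hxx (Subtype.ext (eq_of_seq_eq fun k hk => ?_))
      exact hi'.eq_of_deletion hX hi (seq_mem (hc' x' hx').1 _) (seq_mem (hc' x hx).1 _) hd' hd hk
    rw [Finsupp.sub_apply, Finsupp.smul_apply, Finsupp.single_eq_of_ne hyy.symm, smul_zero,
      sub_zero] at h1
    exact h1
  have hsum : boundary X n ℓ c y = c x * (-1) ^ (i + 1) := by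
    conv_lhs => rw [← Finsupp.sum_single c]
    rw [Finsupp.sum, map_sum, Finsupp.finsetSum_apply, Finset.sum_eq_single x]
    · rw [← mul_one (c x), ← smul_eq_mul, ← Finsupp.smul_single, map_smul, Finsupp.smul_apply, hxy]
      simp
    · intro x' hx' hxx
      rw [← mul_one (c x'), ← smul_eq_mul, ← Finsupp.smul_single, map_smul, Finsupp.smul_apply,
        hother x' hx' hxx, smul_zero]
    · intro hx'
      exact absurd hx hx'
  rw [h] at hsum
  have : c x = 0 := by simpa using hsum.symm
  exact Finsupp.mem_support_iff.1 hx this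

/-- Trade lower tuples for boundaries and upper tuples. The remaining upper part is then itself a
cycle, because critical tuples are cycles, so injectivity of the boundary kills it. -/
theorem exists_critical_of_cycle (hX : IsAligned X) (hF : F.Finite) {c : Chain X (n + 1) ℓ}
    (hc : c ∈ Finsupp.supported ℤ ℤ (chainsIn F (n + 1) ℓ)) (h : boundary X n ℓ c = 0) :
    ∃ a ∈ Finsupp.supported ℤ ℤ (criticalChains F (n + 1) ℓ), c - a ∈ boundaries X (n + 1) ℓ := by
  have hsub : chainsIn F (n + 1) ℓ ⊆
      criticalChains F (n + 1) ℓ ∪ (upperChains F (n + 1) ℓ ∪ lowerChains F (n + 1) ℓ) := by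
    intro x hx
    rcases critical_or_upperAt_or_lowerAt (F := F) (n := n + 1) (z := seq x.1) with h | h | h
    · exact Or.inl ⟨hx, h⟩
    · exact Or.inr (Or.inl ⟨hx, h⟩)
    · exact Or.inr (Or.inr ⟨hx, h⟩)
  have hc := Finsupp.supported_mono (R := ℤ) (M := ℤ) hsub hc
  rw [Finsupp.supported_union, Finsupp.supported_union] at hc
  have hc : c ∈ Finsupp.supported ℤ ℤ (criticalChains F (n + 1) ℓ) ⊔
      (boundaries X (n + 1) ℓ ⊔ Finsupp.supported ℤ ℤ (upperChains F (n + 1) ℓ)) :=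
    sup_le_sup_left (sup_le le_sup_right (supported_lower_le hX hF)) _ hc
  obtain ⟨a, ha, r, hr, rfl⟩ := Submodule.mem_sup.1 hc
  obtain ⟨b, hb, u, hu, rfl⟩ := Submodule.mem_sup.1 hr
  refine ⟨a, ha, ?_⟩
  have hb0 : boundary X n ℓ b = 0 := boundaries_le_cycles (n + 1) ℓ hb
  have hu0 : u = 0 := eq_zero_of_upper hX hu (by
    rw [map_add, map_add, boundary_eq_zero_of_critical ha, hb0, zero_add, zero_add] at h
    exact h)
  rw [hu0, add_zero, add_sub_cancel_left]
  exact hb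

end Reduction

/-! ### Induced maps on homology -/

section Induced

variable {X Y Z : Type*} [MetricSpace X] [MetricSpace Y] [MetricSpace Z] {n : ℕ} {ℓ : ℝ≥0}

theorem chainMap_single (f : X → Y) (x : ProperChain X n ℓ) :
    chainMap f n ℓ (Finsupp.single x 1) = gen ℓ (f ∘ x.1) := by
  simp [chainMap]

/-- A tuple shortened by `f` cannot regain its length under the 1-Lipschitz map `g`. -/
theorem chainMap_comp {f : X → Y} {g : Y → Z} (hg : LipschitzWith 1 g)
    (hf : LipschitzWith 1 f) (c : Chain X n ℓ) :
    chainMap g n ℓ (chainMap f n ℓ c) = chainMap (g ∘ f) n ℓ c := by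
  suffices h : chainMap g n ℓ ∘ₗ chainMap f n ℓ = chainMap (g ∘ f) n ℓ from
    LinearMap.congr_fun h c
  refine Finsupp.lhom_ext' fun x => LinearMap.ext_ring ?_
  simp only [LinearMap.comp_apply, Finsupp.lsingle_apply, chainMap_single]
  by_cases h : IsProperChain ℓ (f ∘ x.1)
  · rw [gen_of_isProperChain h, chainMap_single]
    rfl
  · rw [gen_of_not_isProperChain h, map_zero, gen_of_not_isProperChain]
    intro h'
    have hl : length (f ∘ x.1) = length x.1 := by
      refine le_antisymm (length_comp_le hf _) ?_
      rw [x.2.2, ← h'.2]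
      exact length_comp_le hg (f ∘ x.1)
    exact h ⟨proper_of_comp hf x.1 x.2.1 hl, hl.trans x.2.2⟩

/-- A critical chain relative to `F` is a boundary or consists of points of the inner boundary. -/
theorem mem_boundaries_or_of_critical (hX : IsAligned X) {F : Set X} {x : ProperChain X (n + 1) ℓ}
    (hx : x ∈ criticalChains F (n + 1) ℓ) :
    Finsupp.single x 1 ∈ boundaries X (n + 1) ℓ ∨ ∀ k, x.1 k ∈ innerBoundary X := by
  by_cases h : ∀ k < n + 1, AdjacentPoints (seq x.1 k) (seq x.1 (k + 1))
  · right
    intro k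
    rw [← seq_val x.1]
    rcases Nat.lt_or_ge k (n + 1) with hk | hk
    · exact ⟨_, h k hk⟩
    · obtain rfl : k = Fin.last (n + 1) := Fin.ext (by simp; omega)
      exact ⟨_, (h n (Nat.lt_succ_self n)).symm⟩
  · left
    push Not at h
    obtain ⟨i, hi, hadj⟩ := h
    simp only [AdjacentPoints, not_and, not_forall, not_not] at hadj
    obtain ⟨p, hp⟩ := hadj (x.seq_ne hi)
    have hd := isDeletion_insertNth x.1 (by omega : i + 1 < n + 3) p
    have hs := seq_insertNth x.1 (by omega : i + 1 < n + 3) p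
    -- The point `p` need not lie in `F`. Since it is the only smooth entry, the congruence holds
    -- modulo `⊥`, that is, as an equality.
    have hmem := boundary_single_sub_mem ⟨_, isProperChain_insertNth x hi hp⟩
      (by omega : i + 1 < n + 3) x (by simp) ⊥ fun k hk hsm hne w hw =>
        absurd (hx.2.eq_of_smoothAt_of_deletion hX hi hd (by rwa [hs]) hk hsm) hne
    rw [Submodule.mem_bot, sub_eq_zero] at hmem
    refine ⟨(-1 : ℤ) ^ (i + 1) • Finsupp.single ⟨_, isProperChain_insertNth x hi hp⟩ 1, ?_⟩
    rw [map_smul, hmem, smul_smul, ← mul_pow]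
    simp

/-- A map fixing the inner boundary changes cycles of positive degree only by boundaries. -/
theorem chainMap_sub_mem_boundaries (hX : IsAligned X) {h : X → X} (hh : LipschitzWith 1 h)
    (hfix : ∀ x ∈ innerBoundary X, h x = x) {c : Chain X (n + 1) ℓ}
    (hc : c ∈ cycles X (n + 1) ℓ) : chainMap h (n + 1) ℓ c - c ∈ boundaries X (n + 1) ℓ := by
  let F : Set X := ⋃ x ∈ c.support, Set.range x.1
  have hF : F.Finite := c.support.finite_toSet.biUnion fun x _ => Set.finite_range _
  have hcF : c ∈ Finsupp.supported ℤ ℤ (chainsIn F (n + 1) ℓ) := by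
    rw [Finsupp.mem_supported]
    intro x hx k
    exact Set.mem_biUnion hx ⟨k, rfl⟩
  -- The chains that `h` moves by a boundary; it suffices that `T` contains all boundaries and all
  -- critical tuples.
  let T : Submodule ℤ (Chain X (n + 1) ℓ) :=
    (boundaries X (n + 1) ℓ).comap (chainMap h (n + 1) ℓ - LinearMap.id)
  have hbT : boundaries X (n + 1) ℓ ≤ T := fun b hb =>
    Submodule.sub_mem _ (chainMap_mem_boundaries hh (n + 1) ℓ b hb) hb
  obtain ⟨a, ha, hca⟩ := exists_critical_of_cycle hX hF hcF hc
  have haT : Finsupp.supported ℤ ℤ (criticalChains F (n + 1) ℓ) ≤ T := by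
    rw [Finsupp.supported_eq_span_single, Submodule.span_le]
    rintro _ ⟨x, hx, rfl⟩
    rcases mem_boundaries_or_of_critical hX hx with hb | hb
    · exact hbT hb
    · have hhx : h ∘ x.1 = x.1 := funext fun k => hfix _ (hb k)
      have : chainMap h (n + 1) ℓ (Finsupp.single x 1) = Finsupp.single x 1 := by
        rw [chainMap_single, hhx, gen_of_isProperChain x.2]
      change _ - _ ∈ boundaries X (n + 1) ℓ
      rw [this, LinearMap.id_apply, sub_self]
      exact Submodule.zero_mem _
  have := T.add_mem (hbT hca) (haT ha)
  rw [sub_add_cancel] at this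
  exact this

theorem map_comp_map_eq_id_iff {f : X → Y} {g : Y → X} (hf : LipschitzWith 1 f)
    (hg : LipschitzWith 1 g) : map g hg n ℓ ∘ₗ map f hf n ℓ = LinearMap.id ↔
      ∀ c ∈ cycles X n ℓ, chainMap (g ∘ f) n ℓ c - c ∈ boundaries X n ℓ := by
  constructor
  · intro h c hc
    have := (Submodule.Quotient.eq _).1 (LinearMap.congr_fun h (Submodule.Quotient.mk ⟨c, hc⟩))
    rw [← chainMap_comp hg hf]
    exact this
  · intro h
    refine LinearMap.ext fun c => ?_
    obtain ⟨⟨c, hc⟩, rfl⟩ := Submodule.Quotient.mk_surjective _ c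
    have := h c hc
    rw [← chainMap_comp hg hf] at this
    exact (Submodule.Quotient.eq _).2 this

theorem magnitudeHomologyEquivalent_of_innerBoundary (hX : IsAligned X) (hY : IsAligned Y)
    {f : X → Y} {g : Y → X} (hf : LipschitzWith 1 f) (hg : LipschitzWith 1 g)
    (h : RestrictToInverseIsometries f g (innerBoundary X) (innerBoundary Y)) :
    MagnitudeHomologyEquivalent X Y := by
  refine ⟨f, g, hf, hg, fun n hn ℓ => ?_⟩
  obtain ⟨n, rfl⟩ : ∃ m, n = m + 1 := ⟨n - 1, by omega⟩
  rw [map_comp_map_eq_id_iff, map_comp_map_eq_id_iff]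
  have hgf : LipschitzWith 1 (g ∘ f) := by simpa using hg.comp hf
  have hfg : LipschitzWith 1 (f ∘ g) := by simpa using hf.comp hg
  exact ⟨fun c hc => chainMap_sub_mem_boundaries hX hgf h.left_inv hc,
    fun c hc => chainMap_sub_mem_boundaries hY hfg h.right_inv hc⟩

/-- A generator given by a tuple of pairwise consecutive adjacent points does not occur in any
boundary. -/
theorem boundary_apply_eq_zero {x : ProperChain X n ℓ}
    (hx : ∀ k < n, AdjacentPoints (seq x.1 k) (seq x.1 (k + 1))) {b : Chain X n ℓ}
    (hb : b ∈ boundaries X n ℓ) : b x = 0 := by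
  classical
  suffices h : boundaries X n ℓ ≤ LinearMap.ker (Finsupp.lapply (R := ℤ) (M := ℤ) x) from h hb
  rw [boundaries, LinearMap.range_le_ker_iff]
  refine Finsupp.lhom_ext' fun y => LinearMap.ext_ring ?_
  simp only [LinearMap.comp_apply, Finsupp.lsingle_apply, boundary_single, map_sum, map_smul,
    LinearMap.zero_apply, Finsupp.lapply_apply]
  refine Finset.sum_eq_zero fun r _ => ?_
  by_cases hp : IsProperChain ℓ (r.removeNth y.1)
  · obtain ⟨k, hk, hkn, hs⟩ := (isProperChain_removeNth_iff y r).1 hp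
    rw [gen_of_isProperChain hp, Finsupp.single_eq_of_ne, smul_zero]
    -- The deleted entry would lie strictly between two consecutive, hence adjacent, entries of the
    -- tuple.
    rintro rfl
    have hd := isDeletion_removeNth y.1 r
    rw [hk] at hd
    have := hx k (by omega)
    rw [hd.of_lt (by omega) (Nat.lt_succ_self k), hd.of_ge le_rfl hkn] at this
    exact this.2 _ hs
  · simp [gen_of_not_isProperChain hp]

theorem adjacentPoints_alternating {x y : X} (h : AdjacentPoints x y) {k : ℕ} (hk : k < n) :
    AdjacentPoints (seq (alternating x y n) k) (seq (alternating x y n) (k + 1)) := by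
  rw [seq_alternating hk.le, seq_alternating hk]
  by_cases hk : Even k
  · rw [if_pos hk, if_neg (by simpa [Nat.even_add_one] using hk)]
    exact h
  · rw [if_neg hk, if_pos (by simpa [Nat.even_add_one] using hk)]
    exact h.symm

theorem isProperChain_alternating {x y : X} (h : AdjacentPoints x y) (n : ℕ) :
    IsProperChain (n * nndist x y) (alternating x y n) := by
  rw [isProperChain_iff_seq]
  refine ⟨fun k hk => (adjacentPoints_alternating h hk).1, ?_⟩
  have : ∀ k ∈ Finset.range n, dist (seq (alternating x y n) k)
      (seq (alternating x y n) (k + 1)) = dist x y := by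
    intro k hk
    have hk := Finset.mem_range.1 hk
    rw [seq_alternating hk.le, seq_alternating hk]
    by_cases hk : Even k
    · rw [if_pos hk, if_neg (by simpa [Nat.even_add_one] using hk)]
    · rw [if_neg hk, if_pos (by simpa [Nat.even_add_one] using hk), dist_comm]
  rw [seqLength, Finset.sum_congr rfl this]
  simp

/-- If `g ∘ f` induces the identity on homology of some positive degree then it fixes adjacent
points. -/
theorem fixed_of_adjacentPoints {f : X → Y} {g : Y → X} (hf : LipschitzWith 1 f)
    (hg : LipschitzWith 1 g)
    (h : ∀ ℓ, map g hg (n + 1) ℓ ∘ₗ map f hf (n + 1) ℓ = LinearMap.id) {x y : X}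
    (hxy : AdjacentPoints x y) : g (f x) = x ∧ g (f y) = y := by
  let t : ProperChain X (n + 1) _ := ⟨_, isProperChain_alternating hxy (n + 1)⟩
  have hadj : ∀ k < n + 1, AdjacentPoints (seq t.1 k) (seq t.1 (k + 1)) :=
    fun k hk => adjacentPoints_alternating hxy hk
  -- Entries two places apart coincide, so no entry lies strictly between its neighbours.
  have hcyc : Finsupp.single t 1 ∈ cycles X (n + 1) _ :=
    boundary_single_eq_zero t fun k hk hs => by
      have h1 := (seq_alternating (x := x) (y := y) (by omega : k ≤ n + 1)).trans
        ((seq_alternating (x := x) (y := y) (by omega : k + 2 ≤ n + 1)).trans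
          (by simp [Nat.even_add])).symm
      exact hs.ne h1
  -- The image of `t` minus `t` is a boundary, so its coefficient at `t` vanishes; hence the image
  -- is the generator `t` itself.
  have h1 := boundary_apply_eq_zero hadj ((map_comp_map_eq_id_iff hf hg).1 (h _) _ hcyc)
  rw [chainMap_single] at h1
  by_cases hp : IsProperChain ((n + 1 : ℕ) * nndist x y) ((g ∘ f) ∘ t.1)
  · rw [gen_of_isProperChain hp, Finsupp.sub_apply, Finsupp.single_eq_same, sub_eq_zero] at h1
    have h2 : (⟨_, hp⟩ : ProperChain X (n + 1) _) = t := by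
      by_contra hne
      rw [Finsupp.single_eq_of_ne (Ne.symm hne)] at h1
      exact absurd h1 zero_ne_one
    have h3 : (g ∘ f) ∘ t.1 = t.1 := congrArg Subtype.val h2
    have h4 := congrFun h3 ⟨0, by omega⟩
    have h5 := congrFun h3 ⟨1, by omega⟩
    simpa [t, alternating] using And.intro h4 h5
  · rw [gen_of_not_isProperChain hp] at h1
    simp at h1

end Induced

end MagnitudeHomology

/-! ### Transport of adjacency along 1-Lipschitz maps -/

section InnerBoundary

variable {X Y : Type*} [MetricSpace X] [MetricSpace Y] {f : X → Y} {g : Y → X}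

theorem LipschitzWith.dist_le_of_one (hf : LipschitzWith 1 f) (x y : X) :
    dist (f x) (f y) ≤ dist x y := by
  simpa using hf.dist_le_mul x y

/-- If `p` lies between `f x` and `f y`, going there by `f` and back by `g` increases no distance,
while the triangle inequality through `g p` forces equality throughout. So `g p` lies strictly
between `x` and `y`. -/
theorem AdjacentPoints.map (hf : LipschitzWith 1 f) (hg : LipschitzWith 1 g) {x y : X}
    (hxy : AdjacentPoints x y) (hx : g (f x) = x) (hy : g (f y) = y) :
    AdjacentPoints (f x) (f y) := by
  refine ⟨fun h => hxy.1 (by rw [← hx, ← hy, h]), fun p hp => hxy.2 (g p) ?_⟩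
  have h1 := hg.dist_le_of_one (f x) p
  have h2 := hg.dist_le_of_one p (f y)
  rw [hx] at h1
  rw [hy] at h2
  have h3 := hf.dist_le_of_one x y
  have h4 := dist_triangle x (g p) y
  refine ⟨by linarith [hp.1], ?_, ?_⟩
  · rw [← dist_pos]
    linarith [hp.1, dist_pos.2 hp.2.1]
  · rw [← dist_pos]
    linarith [hp.1, dist_pos.2 hp.2.2]

theorem RestrictToInverseIsometries.of_lipschitz (hf : LipschitzWith 1 f) (hg : LipschitzWith 1 g)
    {A : Set X} {B : Set Y} (hA : Set.MapsTo f A B) (hB : Set.MapsTo g B A)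
    (hgf : ∀ x ∈ A, g (f x) = x) (hfg : ∀ y ∈ B, f (g y) = y) :
    RestrictToInverseIsometries f g A B where
  mapsTo := hA
  mapsTo_inv := hB
  left_inv := hgf
  right_inv := hfg
  dist_eq x hx x' hx' := by
    refine le_antisymm (hf.dist_le_of_one _ _) ?_
    simpa only [hgf x hx, hgf x' hx'] using hg.dist_le_of_one (f x) (f x')
  dist_inv_eq y hy y' hy' := by
    refine le_antisymm (hg.dist_le_of_one _ _) ?_
    simpa only [hfg y hy, hfg y' hy'] using hf.dist_le_of_one (g y) (g y')

theorem restrictToInverseIsometries_of_mutuallyInverse (hf : LipschitzWith 1 f)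
    (hg : LipschitzWith 1 g) {n : ℕ} (hn : 1 ≤ n)
    (h : MagnitudeHomology.MutuallyInverse f g hf hg n) :
    RestrictToInverseIsometries f g (innerBoundary X) (innerBoundary Y) := by
  obtain ⟨n, rfl⟩ : ∃ m, n = m + 1 := ⟨n - 1, by omega⟩
  have hX : ∀ x y, AdjacentPoints x y → g (f x) = x ∧ g (f y) = y := fun x y hxy =>
    MagnitudeHomology.fixed_of_adjacentPoints hf hg (fun ℓ => (h ℓ).1) hxy
  have hY : ∀ x y, AdjacentPoints x y → f (g x) = x ∧ f (g y) = y := fun x y hxy =>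
    MagnitudeHomology.fixed_of_adjacentPoints hg hf (fun ℓ => (h ℓ).2) hxy
  refine .of_lipschitz hf hg ?_ ?_ ?_ ?_
  · rintro x ⟨y, hxy⟩
    exact ⟨f y, hxy.map hf hg (hX x y hxy).1 (hX x y hxy).2⟩
  · rintro x ⟨y, hxy⟩
    exact ⟨g y, hxy.map hg hf (hY x y hxy).1 (hY x y hxy).2⟩
  · rintro x ⟨y, hxy⟩
    exact (hX x y hxy).1
  · rintro x ⟨y, hxy⟩
    exact (hY x y hxy).1

end InnerBoundary

/-! ### The closed convex hull of the inner boundary -/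

section Core

variable {E : Type*} [NormedAddCommGroup E] [InnerProductSpace ℝ E]

/-- The points at least as close to `y` as to `x` form a closed half-space, or the whole space. It
contains `A`, hence `x`, which gives `dist y x ≤ 0`. -/
theorem mem_closedConvexHull_of_dist_le {A : Set E} {x y : E} (hx : x ∈ closedConvexHull ℝ A)
    (h : ∀ a ∈ A, dist y a ≤ dist x a) : y = x := by
  have hset : {a : E | dist y a ≤ dist x a} =
      {a : E | innerSL ℝ (x - y) a ≤ (‖x‖ ^ 2 - ‖y‖ ^ 2) / 2} := by
    ext a
    simp only [Set.mem_ofPred_eq, innerSL_apply_apply, inner_sub_left, dist_eq_norm]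
    rw [← sq_le_sq₀ (norm_nonneg _) (norm_nonneg _), norm_sub_sq_real, norm_sub_sq_real]
    constructor <;> intro h <;> linarith
  have hconv : Convex ℝ {a : E | dist y a ≤ dist x a} := by
    rw [hset]
    exact convex_halfSpace_le (innerSL ℝ (x - y)).isLinear _
  have hclosed : IsClosed {a : E | dist y a ≤ dist x a} :=
    isClosed_le (by fun_prop) (by fun_prop)
  have hsub : A ⊆ {a : E | dist y a ≤ dist x a} := h
  have hmem : dist y x ≤ dist x x := closedConvexHull_min hsub hconv hclosed hx
  rw [dist_self] at hmem
  exact dist_le_zero.1 hmem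

/-- The hypotheses are the variational inequalities of nearest points `v`, `v'` to `u`, `u'`. Adding
them and applying Cauchy–Schwarz shows that projection is 1-Lipschitz. -/
theorem inner_sub_sub_nonpos_dist_le {u u' v v' : E} (h : inner ℝ (u - v) (v' - v) ≤ 0)
    (h' : inner ℝ (u' - v') (v - v') ≤ 0) : dist v v' ≤ dist u u' := by
  rw [dist_eq_norm, dist_eq_norm]
  have h1 : ‖v - v'‖ * ‖v - v'‖ ≤ inner ℝ (u - u') (v - v') := by
    have h2 : inner ℝ (u - v) (v' - v) = -inner ℝ (u - v) (v - v') := by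
      rw [← inner_neg_right, neg_sub]
    have h3 : u - u' = (u - v) - (u' - v') + (v - v') := by abel
    rw [h3, inner_add_left, inner_sub_left, real_inner_self_eq_norm_mul_norm]
    linarith
  have h4 := h1.trans (real_inner_le_norm _ _)
  rcases (norm_nonneg (v - v')).eq_or_lt with h0 | h0
  · rw [← h0]
    exact norm_nonneg _
  · exact le_of_mul_le_mul_right h4 h0

variable {X : Type*} [MetricSpace X] {i : X → E}

/-- The points of a segment with endpoints in `X` which are not in `X` are between two adjacent
points of `X`. -/
theorem mem_closedConvexHull_of_mem_segment (hi : Isometry i) (hc : IsClosed (Set.range i))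
    {x y : X} {p : E} (hp : p ∈ segment ℝ (i x) (i y)) (hpX : p ∉ Set.range i) :
    p ∈ closedConvexHull ℝ (i '' innerBoundary X) := by
  -- By compactness there is a last point of `X` before `p` on the segment from `i x`; used from
  -- both ends, this bounds the gap around `p`.
  have key : ∀ x : X, ∃ a : X, Wbtw ℝ (i x) (i a) p ∧
      ∀ q : X, Wbtw ℝ (i x) (i q) p → dist (i a) p ≤ dist (i q) p := by
    intro x
    have hcpt : IsCompact (segment ℝ (i x) p ∩ Set.range i) := by
      refine IsCompact.inter_right ?_ hc
      rw [segment_eq_image_lineMap]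
      exact isCompact_Icc.image AffineMap.lineMap_continuous
    obtain ⟨_, ⟨ha, a, rfl⟩, hmin⟩ := hcpt.exists_isMinOn
      ⟨i x, left_mem_segment ℝ _ _, x, rfl⟩ (f := fun q => dist q p) (by fun_prop)
    exact ⟨a, mem_segment_iff_wbtw.1 ha,
      fun q hq => hmin ⟨mem_segment_iff_wbtw.2 hq, q, rfl⟩⟩
  have hp' : Wbtw ℝ (i x) p (i y) := mem_segment_iff_wbtw.1 hp
  obtain ⟨a, hxa, ha⟩ := key x
  obtain ⟨b, hyb, hb⟩ := key y
  have hapb : Wbtw ℝ (i a) p (i b) := (hp'.trans_left_right hxa).trans_right_left hyb.symm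
  have hpa : ∀ q, p ≠ i q := fun q h => hpX ⟨q, h.symm⟩
  have hsb : StrictlyBetween (i a) p (i b) :=
    strictlyBetween_iff_sbtw.2 ⟨hapb, hpa a, hpa b⟩
  have hadj : AdjacentPoints a b := by
    refine ⟨fun h => hsb.ne (by rw [h]), fun q hq => ?_⟩
    rw [← hi.strictlyBetween_iff] at hq
    have clos : ∀ {x c : X}, Wbtw ℝ (i x) (i c) p →
        (∀ q : X, Wbtw ℝ (i x) (i q) p → dist (i c) p ≤ dist (i q) p) →
        ¬ StrictlyBetween (i c) (i q) p := by
      intro x c hxc hc h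
      have h1 := hc q (hxc.trans_right (strictlyBetween_iff_sbtw.1 h).wbtw)
      linarith [h.1, dist_pos.2 h.2.1]
    -- A point of `X` between `a` and `b` would lie on one side of `p` and be closer to it than the
    -- chosen endpoint on that side.
    rcases (isAligned_of_isometry (isometry_id (α := E))).total hq hsb (hpa q).symm with h | h
    · exact clos hxa ha h
    · exact clos hyb hb (hq.symm.trans_middle h.symm)
  have hsub := subset_closedConvexHull (𝕜 := ℝ) (s := i '' innerBoundary X)
  exact convex_closedConvexHull.segment_subset
    (hsub ⟨a, ⟨b, hadj⟩, rfl⟩) (hsub ⟨b, ⟨a, hadj.symm⟩, rfl⟩) (mem_segment_iff_wbtw.2 hapb)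

/-- `X` together with the closed convex hull of its inner boundary is star-shaped around the points
of this hull. -/
theorem segment_subset_union_closedConvexHull (hi : Isometry i) (hc : IsClosed (Set.range i))
    (x : X) {c : E} (hcC : c ∈ closedConvexHull ℝ (i '' innerBoundary X)) :
    segment ℝ (i x) c ⊆ Set.range i ∪ closedConvexHull ℝ (i '' innerBoundary X) := by
  set C := closedConvexHull ℝ (i '' innerBoundary X) with hC
  have hconv : Convex ℝ C := convex_closedConvexHull
  have hclosed : IsClosed C := isClosed_closedConvexHull
  let T : Set E := C ∩ {c | ∀ x : X, segment ℝ (i x) c ⊆ Set.range i ∪ C}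
  suffices h : C ⊆ T from (h hcC).2 x
  refine closedConvexHull_min ?_ ?_ ?_
  · rintro _ ⟨a, ha, rfl⟩
    refine ⟨subset_closedConvexHull ⟨a, ha, rfl⟩, fun x p hp => ?_⟩
    by_cases hpX : p ∈ Set.range i
    · exact Or.inl hpX
    · exact Or.inr (mem_closedConvexHull_of_mem_segment hi hc hp hpX)
  · rw [convex_iff_segment_subset]
    rintro c₁ ⟨h₁, h₁'⟩ c₂ ⟨h₂, h₂'⟩ c hcc
    refine ⟨hconv.segment_subset h₁ h₂ hcc, fun x p hp => ?_⟩
    -- In the triangle with vertices `i x`, `c₁`, `c₂`, the point `p` also lies on a segment from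
    -- some `u` on the side `[i x, c₁]` to `c₂`. If `u` is in `X`, use the property of `c₂`; if it
    -- is in `C`, use convexity.
    have hp' : p ∈ convexJoin ℝ {i x} (convexJoin ℝ {c₁} {c₂}) := by
      rw [convexJoin_singletons, mem_convexJoin]
      exact ⟨i x, rfl, c, hcc, hp⟩
    rw [← convexJoin_assoc, convexJoin_singletons, mem_convexJoin] at hp'
    obtain ⟨u, hu, _, rfl, hpu⟩ := hp'
    rcases h₁' x hu with ⟨y, rfl⟩ | huC
    · exact h₂' y hpu
    · exact Or.inr (hconv.segment_subset huC h₂ hpu)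
  · have hset : {c | ∀ x : X, segment ℝ (i x) c ⊆ Set.range i ∪ C} =
        ⋂ (x : X) (t ∈ Set.Icc (0 : ℝ) 1),
          (fun c => AffineMap.lineMap (i x) c t) ⁻¹' (Set.range i ∪ C) := by
      ext c
      simp only [segment_eq_image_lineMap, Set.mem_ofPred_eq, Set.mem_iInter, Set.subset_def,
        Set.forall_mem_image, Set.mem_preimage]
    refine hclosed.inter ?_
    rw [hset]
    refine isClosed_iInter fun x => isClosed_iInter fun t => isClosed_iInter fun _ =>
      (hc.union hclosed).preimage ?_
    simp only [AffineMap.lineMap_apply_module]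
    fun_prop

/-- The nearest point projection to the closed convex hull of the inner boundary retracts `X`. -/
theorem exists_retraction [CompleteSpace E] (hi : Isometry i) (hc : IsClosed (Set.range i))
    (hne : (innerBoundary X).Nonempty) :
    ∃ π : X → X, LipschitzWith 1 π ∧
      (∀ x, i (π x) ∈ closedConvexHull ℝ (i '' innerBoundary X)) ∧
      ∀ x, i x ∈ closedConvexHull ℝ (i '' innerBoundary X) → π x = x := by
  have hstar := fun x c => segment_subset_union_closedConvexHull hi hc x (c := c)
  have hneC := (hne.image i).mono (subset_closedConvexHull (𝕜 := ℝ))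
  have hconv : Convex ℝ (closedConvexHull ℝ (i '' innerBoundary X)) := convex_closedConvexHull
  have hclosed : IsClosed (closedConvexHull ℝ (i '' innerBoundary X)) := isClosed_closedConvexHull
  generalize closedConvexHull ℝ (i '' innerBoundary X) = C at *
  have hproj : ∀ x : X, ∃ y : X, i y ∈ C ∧ ∀ w ∈ C, inner ℝ (i x - i y) (w - i y) ≤ 0 := by
    intro x
    obtain ⟨v, hv, hmin⟩ := exists_norm_eq_iInf_of_complete_convex hneC hclosed.isComplete hconv (i x)
    rw [norm_eq_iInf_iff_real_inner_le_zero hconv hv] at hmin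
    suffices h : v ∈ Set.range i by
      obtain ⟨y, rfl⟩ := h
      exact ⟨y, hv, hmin⟩
    by_cases hxv : i x = v
    · exact ⟨x, hxv⟩
    have hcl : IsClosed ((fun t : ℝ => AffineMap.lineMap (i x) v t) ⁻¹' Set.range i) :=
      hc.preimage AffineMap.lineMap_continuous
    -- Points before the foot `v` are closer to `i x` than `v`, so they are outside `C` and must lie
    -- in `X`. As `X` is closed, so does `v`.
    have hsub : Set.Ico (0 : ℝ) 1 ⊆ (fun t : ℝ => AffineMap.lineMap (i x) v t) ⁻¹' Set.range i := by
      intro t ht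
      have hmem : AffineMap.lineMap (i x) v t ∈ segment ℝ (i x) v := by
        rw [segment_eq_image_lineMap]
        exact ⟨t, ⟨ht.1, ht.2.le⟩, rfl⟩
      rcases hstar x v hv hmem with h | h
      · exact h
      · have h1 := hmin _ h
        have h2 : AffineMap.lineMap (i x) v t - v = (1 - t) • (i x - v) := by
          rw [AffineMap.lineMap_apply_module]
          module
        rw [h2, inner_smul_right, real_inner_self_eq_norm_sq] at h1
        have h3 : 0 < ‖i x - v‖ := norm_pos_iff.2 (sub_ne_zero.2 hxv)
        have h4 : 0 < 1 - t := sub_pos.2 ht.2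
        exact absurd h1 (not_le.2 (by positivity))
    have h1 := closure_minimal hsub hcl
    rw [closure_Ico zero_ne_one] at h1
    simpa using h1 (Set.right_mem_Icc.2 zero_le_one)
  choose π hπ hπ' using hproj
  refine ⟨π, LipschitzWith.of_dist_le_mul fun x y => ?_, hπ, fun x hx => ?_⟩
  · rw [NNReal.coe_one, one_mul, ← hi.dist_eq, ← hi.dist_eq x]
    exact inner_sub_sub_nonpos_dist_le (hπ' x _ (hπ y)) (hπ' y _ (hπ x))
  · have := hπ' x _ hx
    rw [real_inner_self_nonpos, sub_eq_zero] at this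
    exact (hi.injective this).symm

end Core

/-! ### Cores of closed Euclidean sets -/

section Euclidean

variable {X Y : Type*} [MetricSpace X] [MetricSpace Y] {N M : ℕ}
  {i : X → EuclideanSpace ℝ (Fin N)} {j : Y → EuclideanSpace ℝ (Fin M)}

theorem innerBoundary_subset_core : innerBoundary X ⊆ core i :=
  fun x hx => subset_closedConvexHull ⟨x, hx, rfl⟩

theorem core_nonempty_iff : (core i).Nonempty ↔ (innerBoundary X).Nonempty := by
  refine ⟨fun ⟨x, hx⟩ => ?_, fun h => h.mono innerBoundary_subset_core⟩
  by_contra h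
  rw [Set.not_nonempty_iff_eq_empty] at h
  have hx : i x ∈ closedConvexHull ℝ (i '' innerBoundary X) := hx
  rw [h, Set.image_empty] at hx
  exact closedConvexHull_min (𝕜 := ℝ) subset_rfl convex_empty isClosed_empty hx

theorem eqOn_core_of_lipschitz (hi : Isometry i) {h : X → X} (hh : LipschitzWith 1 h)
    (hfix : ∀ x ∈ innerBoundary X, h x = x) : ∀ x ∈ core i, h x = x := by
  intro x hx
  refine hi.injective (mem_closedConvexHull_of_dist_le hx ?_)
  rintro _ ⟨a, ha, rfl⟩
  rw [hi.dist_eq, hi.dist_eq]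
  simpa only [hfix a ha] using hh.dist_le_of_one x a

theorem RestrictToInverseIsometries.of_eq_empty {f : X → Y} {g : Y → X} {A : Set X} {B : Set Y}
    (hA : A = ∅) (hB : B = ∅) : RestrictToInverseIsometries f g A B := by
  subst hA hB
  constructor <;> simp [Set.MapsTo]

theorem exists_core_of_innerBoundary (hi : Isometry i) (hiX : IsClosed (Set.range i))
    (hj : Isometry j) (hjY : IsClosed (Set.range j)) {f : X → Y} {g : Y → X}
    (hf : LipschitzWith 1 f) (hg : LipschitzWith 1 g)
    (h : RestrictToInverseIsometries f g (innerBoundary X) (innerBoundary Y)) :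
    ∃ (f : X → Y) (g : Y → X), LipschitzWith 1 f ∧ LipschitzWith 1 g ∧
      RestrictToInverseIsometries f g (core i) (core j) := by
  -- With empty inner boundary there is nothing to project onto, but then both cores are empty.
  -- Otherwise the maps are composed with the retractions.
  rcases (innerBoundary X).eq_empty_or_nonempty with h0 | hX
  · have hY : ¬ (innerBoundary Y).Nonempty := fun ⟨y, hy⟩ => by
      have := h.mapsTo_inv hy
      rw [h0] at this
      exact this
    rw [← core_nonempty_iff (i := j), Set.not_nonempty_iff_eq_empty] at hY
    have hX : ¬ (innerBoundary X).Nonempty := by simp [h0]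
    rw [← core_nonempty_iff (i := i), Set.not_nonempty_iff_eq_empty] at hX
    exact ⟨f, g, hf, hg, .of_eq_empty hX hY⟩
  · have hY : (innerBoundary Y).Nonempty := hX.image f |>.mono h.mapsTo.image_subset
    obtain ⟨π, hπ, hπC, hπf⟩ := exists_retraction hi hiX hX
    obtain ⟨τ, hτ, hτC, hτf⟩ := exists_retraction hj hjY hY
    have hf' : LipschitzWith 1 (τ ∘ f) := by simpa using hτ.comp hf
    have hg' : LipschitzWith 1 (π ∘ g) := by simpa using hπ.comp hg
    have hgf : LipschitzWith 1 ((π ∘ g) ∘ (τ ∘ f)) := by simpa using hg'.comp hf'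
    have hfg : LipschitzWith 1 ((τ ∘ f) ∘ (π ∘ g)) := by simpa using hf'.comp hg'
    refine ⟨τ ∘ f, π ∘ g, hf', hg', .of_lipschitz hf' hg' (fun x _ => hτC _) (fun y _ => hπC _)
      (eqOn_core_of_lipschitz hi hgf fun x hx => ?_)
      (eqOn_core_of_lipschitz hj hfg fun y hy => ?_)⟩
    · simp only [Function.comp_apply]
      rw [hτf _ (innerBoundary_subset_core (h.mapsTo hx)), h.left_inv x hx,
        hπf _ (innerBoundary_subset_core hx)]
    · simp only [Function.comp_apply]
      rw [hπf _ (innerBoundary_subset_core (h.mapsTo_inv hy)), h.right_inv y hy,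
        hτf _ (innerBoundary_subset_core hy)]

theorem RestrictToInverseIsometries.innerBoundary_of_core {f : X → Y} {g : Y → X}
    (hf : LipschitzWith 1 f) (hg : LipschitzWith 1 g)
    (h : RestrictToInverseIsometries f g (core i) (core j)) :
    RestrictToInverseIsometries f g (innerBoundary X) (innerBoundary Y) := by
  have hX : ∀ x ∈ innerBoundary X, g (f x) = x :=
    fun x hx => h.left_inv x (innerBoundary_subset_core hx)
  have hY : ∀ y ∈ innerBoundary Y, f (g y) = y :=
    fun y hy => h.right_inv y (innerBoundary_subset_core hy)
  refine .of_lipschitz hf hg ?_ ?_ hX hY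
  · rintro x ⟨y, hxy⟩
    exact ⟨f y, hxy.map hf hg (hX x ⟨y, hxy⟩) (hX y ⟨x, hxy.symm⟩)⟩
  · rintro x ⟨y, hxy⟩
    exact ⟨g y, hxy.map hg hf (hY x ⟨y, hxy⟩) (hY y ⟨x, hxy.symm⟩)⟩

theorem exists_of_core_isometryEquiv [Nonempty X] [Nonempty Y] (hi : Isometry i)
    (hiX : IsClosed (Set.range i)) (hj : Isometry j) (hjY : IsClosed (Set.range j))
    (e : core i ≃ᵢ core j) :
    ∃ (f : X → Y) (g : Y → X), LipschitzWith 1 f ∧ LipschitzWith 1 g ∧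
      RestrictToInverseIsometries f g (core i) (core j) := by
  rcases (core i).eq_empty_or_nonempty with hX | hX
  · have hY : core j = ∅ := by
      rw [Set.eq_empty_iff_forall_notMem]
      intro y hy
      exact Set.eq_empty_iff_forall_notMem.1 hX _ (e.symm ⟨y, hy⟩).2
    obtain ⟨x⟩ := ‹Nonempty X›
    obtain ⟨y⟩ := ‹Nonempty Y›
    -- For empty cores constant maps suffice; this is where nonemptiness of `X` and `Y` enters.
    exact ⟨_, _, LipschitzWith.const' y, LipschitzWith.const' x, .of_eq_empty hX hY⟩
  · have hY : (core j).Nonempty := ⟨_, (e ⟨_, hX.some_mem⟩).2⟩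
    obtain ⟨π, hπ, hπC, hπf⟩ := exists_retraction hi hiX (core_nonempty_iff.1 hX)
    obtain ⟨τ, hτ, hτC, hτf⟩ := exists_retraction hj hjY (core_nonempty_iff.1 hY)
    -- Retract onto the core, then apply the isometry.
    have hf : LipschitzWith 1 fun x => (e ⟨π x, hπC x⟩ : Y) :=
      LipschitzWith.of_dist_le_mul fun x x' => by
        rw [← Subtype.dist_eq, e.dist_eq]
        exact hπ.dist_le_mul x x'
    have hg : LipschitzWith 1 fun y => (e.symm ⟨τ y, hτC y⟩ : X) :=
      LipschitzWith.of_dist_le_mul fun y y' => by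
        rw [← Subtype.dist_eq, e.symm.dist_eq]
        exact hτ.dist_le_mul y y'
    have hf' : ∀ x (hx : x ∈ core i), (e ⟨π x, hπC x⟩ : Y) = e ⟨x, hx⟩ :=
      fun x hx => by simp only [hπf x hx]
    have hg' : ∀ y (hy : y ∈ core j), (e.symm ⟨τ y, hτC y⟩ : X) = e.symm ⟨y, hy⟩ :=
      fun y hy => by simp only [hτf y hy]
    refine ⟨_, _, hf, hg, .of_lipschitz hf hg (fun x _ => Subtype.coe_prop _)
      (fun y _ => Subtype.coe_prop _) (fun x hx => ?_) (fun y hy => ?_)⟩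
    · simp only [hf' x hx]
      rw [hg' _ (Subtype.coe_prop _)]
      simp
    · simp only [hg' y hy]
      rw [hf' _ (Subtype.coe_prop _)]
      simp

/-- The isometry between two sets to which mutually inverse maps restrict. -/
def RestrictToInverseIsometries.isometryEquiv {f : X → Y} {g : Y → X} {A : Set X} {B : Set Y}
    (h : RestrictToInverseIsometries f g A B) : A ≃ᵢ B where
  toFun x := ⟨f x, h.mapsTo x.2⟩
  invFun y := ⟨g y, h.mapsTo_inv y.2⟩
  left_inv x := Subtype.ext (h.left_inv x x.2)
  right_inv y := Subtype.ext (h.right_inv y y.2)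
  isometry_toFun := Isometry.of_dist_eq fun x y => h.dist_eq x x.2 y y.2

end Euclidean

theorem theorem8p1 {X Y : Type*} [MetricSpace X] [MetricSpace Y] [Nonempty X] [Nonempty Y]
    {N M : ℕ} (i : X → EuclideanSpace ℝ (Fin N)) (hi : Isometry i) (hiX : IsClosed (Set.range i))
    (j : Y → EuclideanSpace ℝ (Fin M)) (hj : Isometry j) (hjY : IsClosed (Set.range j)) :
    [ MagnitudeHomologyEquivalent X Y,
      ∃ (f : X → Y) (g : Y → X) (hf : LipschitzWith 1 f) (hg : LipschitzWith 1 g),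
        ∃ n : ℕ, 1 ≤ n ∧ MagnitudeHomology.MutuallyInverse f g hf hg n,
      ∃ (f : X → Y) (g : Y → X), LipschitzWith 1 f ∧ LipschitzWith 1 g ∧
        RestrictToInverseIsometries f g (innerBoundary X) (innerBoundary Y),
      ∃ (f : X → Y) (g : Y → X), LipschitzWith 1 f ∧ LipschitzWith 1 g ∧
        RestrictToInverseIsometries f g (core i) (core j),
      Nonempty (core i ≃ᵢ core j) ].TFAE := by
  tfae_have 1 → 2 := fun ⟨f, g, hf, hg, h⟩ => ⟨f, g, hf, hg, 1, le_rfl, h 1 le_rfl⟩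
  tfae_have 2 → 3 := fun ⟨f, g, hf, hg, _, hn, h⟩ =>
    ⟨f, g, hf, hg, restrictToInverseIsometries_of_mutuallyInverse hf hg hn h⟩
  tfae_have 3 → 1 := fun ⟨_, _, hf, hg, h⟩ =>
    MagnitudeHomology.magnitudeHomologyEquivalent_of_innerBoundary (isAligned_of_isometry hi)
      (isAligned_of_isometry hj) hf hg h
  tfae_have 3 → 4 := fun ⟨_, _, hf, hg, h⟩ => exists_core_of_innerBoundary hi hiX hj hjY hf hg h
  tfae_have 4 → 3 := fun ⟨f, g, hf, hg, h⟩ => ⟨f, g, hf, hg, h.innerBoundary_of_core hf hg⟩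
  tfae_have 4 → 5 := fun ⟨_, _, _, _, h⟩ => ⟨h.isometryEquiv⟩
  tfae_have 5 → 4 := fun ⟨e⟩ => exists_of_core_isometryEquiv hi hiX hj hjY e
  tfae_finish
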